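/- Graphs are finite directed graphs without loops or multiple edges. Let $\Bbbk$ be $\mathbb R$ or $\mathbb C$. For a graph $H=(V_H,E_H)$ with $n=|V_H|$ vertices and $m=|E_H|$ edges, let $\Theta_H\subseteq \Bbbk^{V_H\times V_H}$ be the space of all matrices $A$ such that $A_{ij}=0$ whenever $i\neq j$ and $j\to i$ is not an edge of $H$ (the diagonal entries are free). For a vertex $r\in V_H$, called the input-output compartment, let $A_{(r)}$ be the matrix obtained from $A$ by deleting row and column $r$, and let $$c_{H,r}:\Theta_H\to \Bbbk^{2n-1}$$ be the map that sends $A$ to the $n$ non-leading coefficients of the characteristic polynomial of $A$ followed by the $n-1$ non-leading coefficients of the characteristic polynomial of $A_{(r)}$. We say that $H$ with input-output compartment $r$ *has the expected dimension* if the image of $c_{H,r}$ (equivalently, its Zariski closure) has dimension $m+1$. **Proposition.** Let $G'=(V',E')$ and $G''=(V'',E'')$ be strongly connected graphs with $V'\cap V''=\{v\}$ and $E'\cap E''=\emptyset$, and let $1\in V'$ (the case $v=1$ is allowed). Put $G=(V'\cup V'',E'\cup E'')$. Let $1$ be the input-output compartment of $G'$ and of $G$, and let $v$ be the input-output compartment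 of $G''$. 1. If both $G'$ and $G''$ have the expected dimension, then $G$ has the expected dimension. 2. If $G''$ does not have the expected dimension, then $G$ does not have the expected dimension. -/

import Mathlib

/-- A finite directed simple graph: no loops, no multiple edges. The pair `(j, i)` in `edges`
is the edge `j → i`. The vertices live in an ambient type, so that two graphs can share
vertices. -/
structure CompartmentGraph (V : Type*) where
  verts : Finset V
  edges : Finset (V × V)
  mem_verts : ∀ e ∈ edges, e.1 ∈ verts ∧ e.2 ∈ verts
  loopless : ∀ e ∈ edges, e.1 ≠ e.2

namespace CompartmentGraph

/-- The graph `(V' ∪ V'', E' ∪ E'')`. -/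
def union {V : Type*} [DecidableEq V] (G₁ G₂ : CompartmentGraph V) : CompartmentGraph V where
  verts := G₁.verts ∪ G₂.verts
  edges := G₁.edges ∪ G₂.edges
  mem_verts e he := by
    rcases Finset.mem_union.1 he with h | h
    · exact ⟨Finset.mem_union_left _ (G₁.mem_verts e h).1,
        Finset.mem_union_left _ (G₁.mem_verts e h).2⟩
    · exact ⟨Finset.mem_union_right _ (G₂.mem_verts e h).1,
        Finset.mem_union_right _ (G₂.mem_verts e h).2⟩
  loopless e he := by
    rcases Finset.mem_union.1 he with h | h
    · exact G₁.loopless e h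
    · exact G₂.loopless e h

/-- There is a directed path from every vertex to every other vertex. -/
def StronglyConnected {V : Type*} (G : CompartmentGraph V) : Prop :=
  ∀ i ∈ G.verts, ∀ j ∈ G.verts, Relation.ReflTransGen (fun a b => (a, b) ∈ G.edges) i j

/-- The parameter space `Θ_G`: all matrices indexed by the vertices whose off-diagonal entry
`(i, j)` vanishes unless `j → i` is an edge. Every compartment has an independent leak, so the
diagonal entries are free. -/
def parameterSpace (𝕜 : Type*) [Field 𝕜] {V : Type*} (G : CompartmentGraph V) :
    Set (Matrix G.verts G.verts 𝕜) :=
  {A | ∀ i j : G.verts, i ≠ j → ((j : V), (i : V)) ∉ G.edges → A i j = 0}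

/-- The matrix obtained from `A` by deleting the row and the column of the vertex `r`. -/
def deleteVertex {𝕜 : Type*} {V : Type*} (G : CompartmentGraph V) (r : V)
    (A : Matrix G.verts G.verts 𝕜) :
    Matrix {i : G.verts // (i : V) ≠ r} {i : G.verts // (i : V) ≠ r} 𝕜 :=
  A.submatrix Subtype.val Subtype.val

/-- The double characteristic polynomial map for the input-output compartment `r`: it lists the
`n` non-leading coefficients of the characteristic polynomial of `A` and the `n - 1` non-leading
coefficients of the characteristic polynomial of `A` with row and column `r` deleted
(the coefficient of the `k`-th power of the variable stands at position `k`). -/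
noncomputable def doubleCharpoly (𝕜 : Type*) [Field 𝕜] {V : Type*} [DecidableEq V]
    (G : CompartmentGraph V) (r : V) (A : Matrix G.verts G.verts 𝕜) :
    Fin G.verts.card ⊕ Fin (G.verts.card - 1) → 𝕜 :=
  Sum.elim (fun k => A.charpoly.coeff k) (fun k => (G.deleteVertex r A).charpoly.coeff k)

end CompartmentGraph

/-- The dimension of (the Zariski closure of) a nonempty subset `S` of an affine space: the
transcendence degree of the coordinate ring, that is, of the polynomial ring modulo the ideal of
all polynomials that vanish on `S`. -/
noncomputable def zariskiDim {𝕜 : Type*} [Field 𝕜] {σ : Type*} (S : Set (σ → 𝕜)) : Cardinal :=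
  Algebra.trdeg 𝕜 (MvPolynomial σ 𝕜 ⧸ MvPolynomial.vanishingIdeal 𝕜 S)

/-- `G` with input-output compartment `r` has the expected dimension over `𝕜`: the image of the
double characteristic polynomial map on the parameter space has dimension `m + 1`, where `m` is
the number of edges. -/
def CompartmentGraph.HasExpectedDimension (𝕜 : Type*) [Field 𝕜] {V : Type*} [DecidableEq V]
    (G : CompartmentGraph V) (r : V) : Prop :=
  zariskiDim (G.doubleCharpoly 𝕜 r '' G.parameterSpace 𝕜) = ((G.edges.card + 1 : ℕ) : Cardinal)

/-! Evaluated at a generic matrix, with entries algebraically independent over the base field, the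
dimension of the image becomes the rank, in the algebraic-independence matroid, of the coefficients
of the two characteristic polynomials (`hasExpectedDimension_iff`). Any other matrix gives at most
this rank (`eRk_coeffSet_le`).

Let f, f_r be the characteristic polynomials of G', whole and without r, and g, h their diagonal
minors at v. Let d be the characteristic polynomial of G'' without v and p the feedback from v
through G'' back to v, so that G'' has characteristic polynomial (X - a) d - p, with a the entry at
(v, v). Cutting G at v gives d f - p g and d f_r - p h.

Upper bound: a diagonal conjugation turns the entries on a spanning tree rooted at v into 1. Besides
a, at most m' parameters remain, and f, f_r, g, h depend only on these (`exists_generators`). The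
coefficients for G'' determine a, d and p, so the rank for G is at most m' plus the rank for G''
(`eRk_coeffSet_union_le`). Since the latter is at most m'' + 1, this gives part 2 and half of part
1.

Lower bound: replace p by ε p with ε transcendental over the field K of the entries. The claim is
that f, f_r, d, p are algebraic over ε and the coefficients of d f - ε p g and d f_r - ε p h
(`coeff_mem_closure_deformedPoly`). If not, some derivation δ kills the latter but not all of the
former. After clearing denominators, δf, δf_r, δd and ε δp have coefficients in K[ε]; so do δg and
δh, because the expected dimension of G' makes g and h algebraic over f and f_r. Modulo ε this
leaves two linear relations, and f h - g f_r is coprime to d, which forces all four values to vanish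
modulo ε. Now δ/ε has the same properties, so the values are divisible by every power of ε and are
zero. Finally f, f_r contribute rank m' + 1 and d, p at least m'', in disjoint sets of variables,
and ε is independent of both. -/

open Polynomial

/-! ### Transcendence degree as matroid rank -/

section TranscendenceDegree

variable {k Ω : Type*} [Field k] [Field Ω] [Algebra k Ω]

/-- A transcendence basis of `k[S]` can be chosen inside `S`, so both sides count the same
independent sets. -/
theorem toENat_trdeg_adjoin (S : Set Ω) :
    Cardinal.toENat (Algebra.trdeg k (Algebra.adjoin k S)) =
      (AlgebraicIndependent.matroid k Ω).eRk S := by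
  have hinj : Function.Injective (Algebra.adjoin k S).val := Subtype.val_injective
  apply le_antisymm
  · have : Algebra.IsAlgebraic
        (Algebra.adjoin k (Subtype.val ⁻¹' S : Set (Algebra.adjoin k S))) (Algebra.adjoin k S) := by
      refine ⟨fun x => ?_⟩
      have hx : x ∈ Algebra.adjoin k (Subtype.val ⁻¹' S : Set (Algebra.adjoin k S)) := by
        rw [Algebra.adjoin_adjoin_coe_preimage]; trivial
      exact isAlgebraic_algebraMap (⟨x, hx⟩ :
        Algebra.adjoin k (Subtype.val ⁻¹' S : Set (Algebra.adjoin k S)))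
    obtain ⟨t, ht, hb⟩ :=
      exists_isTranscendenceBasis_subset (R := k) (Subtype.val ⁻¹' S : Set (Algebra.adjoin k S))
    rw [← hb.cardinalMk_eq_trdeg]
    change t.encard ≤ _
    rw [← hinj.encard_image t]
    refine Matroid.Indep.encard_le_eRk_of_subset ?_ ?_
    · exact (AlgebraicIndependent.map' hb.1 hinj).to_subtype_range' (by ext; simp)
    · rintro _ ⟨a, ha, rfl⟩
      exact ht ha
  · rw [Matroid.eRk_le_iff]
    intro I hI hind
    have hi : AlgebraicIndependent k
        (fun i : I => (⟨i, Algebra.subset_adjoin (hI i.2)⟩ : Algebra.adjoin k S)) :=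
      AlgebraicIndependent.of_comp (Algebra.adjoin k S).val hind
    exact Cardinal.toENat.monotone' hi.cardinalMk_le_trdeg

theorem mem_closure_iff_isAlgebraic_adjoin {S : Set Ω} {x : Ω} :
    x ∈ (AlgebraicIndependent.matroid k Ω).closure S ↔ IsAlgebraic (Algebra.adjoin k S) x := by
  rw [AlgebraicIndependent.matroid_closure_eq]; rfl

theorem mem_closure_iff_isAlgebraic {S : Set Ω} {x : Ω} :
    x ∈ (AlgebraicIndependent.matroid k Ω).closure S ↔
      IsAlgebraic (IntermediateField.adjoin k S) x := by
  rw [mem_closure_iff_isAlgebraic_adjoin]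
  exact IntermediateField.isAlgebraic_adjoin_iff.symm

/-- The matroid closure of a set in a field extension, as an intermediate field. -/
noncomputable def algClosureOf (k : Type*) {Ω : Type*} [Field k] [Field Ω] [Algebra k Ω]
    (S : Set Ω) : IntermediateField k Ω :=
  (algebraicClosure (IntermediateField.adjoin k S) Ω).restrictScalars k

theorem mem_algClosureOf {S : Set Ω} {x : Ω} :
    x ∈ algClosureOf k S ↔ x ∈ (AlgebraicIndependent.matroid k Ω).closure S := by
  rw [mem_closure_iff_isAlgebraic]
  simp [algClosureOf, mem_algebraicClosure_iff]

end TranscendenceDegree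

/-- Differentiate the minimal polynomial, which is separable in characteristic zero. The target is
an arbitrary module because the lemma is applied with values in `Ω` modulo the polynomial ring
`K[X]`. -/
theorem Derivation.eq_zero_of_isAlgebraic {k K M : Type*} [Field k] [Field K] [Algebra k K]
    [CharZero k] [AddCommGroup M] [Module K M] [Module k M] [IsScalarTower k K M]
    (D : Derivation k K M) {S : Set K}
    (hS : ∀ s ∈ S, D s = 0) {x : K} (hx : IsAlgebraic (IntermediateField.adjoin k S) x) :
    D x = 0 := by
  have hz : ∀ y ∈ IntermediateField.adjoin k S, D y = 0 := by
    intro y hy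
    induction hy using IntermediateField.adjoin_induction with
    | mem s hs => exact hS s hs
    | algebraMap a => simp
    | add a b _ _ ha hb => simp [ha, hb]
    | inv a _ ha =>
      rcases eq_or_ne a 0 with rfl | h0
      · simp
      have h1 : a • D a⁻¹ + a⁻¹ • D a = 0 := by
        rw [← D.leibniz, mul_inv_cancel₀ h0, D.map_one_eq_zero]
      rw [ha, smul_zero, add_zero] at h1
      exact (smul_eq_zero.1 h1).resolve_left h0
    | mul a b _ _ ha hb => simp [ha, hb]
  let D' : Derivation (IntermediateField.adjoin k S) K M :=
    { toFun := D
      map_add' := by simp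
      map_smul' := fun r x => by
        rw [IntermediateField.smul_def, smul_eq_mul, D.leibniz, hz _ r.2, smul_zero, add_zero]
        rfl
      map_one_eq_zero' := by simp
      leibniz' := by simp }
  have hint := hx.isIntegral
  have h0 := D'.map_aeval (minpoly _ x) x
  rw [minpoly.aeval, map_zero] at h0
  have hne : aeval x (derivative (minpoly (IntermediateField.adjoin k S) x)) ≠ 0 :=
    (minpoly.irreducible hint).separable.aeval_derivative_ne_zero (minpoly.aeval _ _)
  exact (smul_eq_zero.1 h0.symm).resolve_left hne

open scoped IntermediateField.algebraAdjoinAdjoin in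
-- Extend `x` to a transcendence basis and take the partial derivative along `x`. It extends to `Ω`
-- because localizations and separable algebraic extensions are formally étale.
theorem exists_derivation_ne_zero_of_transcendental {E Ω : Type*} [Field E] [Field Ω] [Algebra E Ω]
    [CharZero E] {x : Ω} (hx : Transcendental E x) :
    ∃ D : Derivation E Ω Ω, D x ≠ 0 := by
  have hx1 : AlgebraicIndepOn E id ({x} : Set Ω) := by
    exact algebraicIndependent_unique_type_iff.2 hx
  obtain ⟨t, hxt, hb⟩ := exists_isTranscendenceBasis_superset hx1
  have hxt' : x ∈ t := hxt (Set.mem_singleton x)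
  have halg := hb.isAlgebraic_field
  have hsep : Algebra.IsSeparable (IntermediateField.adjoin E (Set.range ((↑) : t → Ω))) Ω :=
    inferInstance
  have h1 : Algebra.FormallyEtale (IntermediateField.adjoin E (Set.range ((↑) : t → Ω))) Ω :=
    Algebra.FormallyEtale.of_isSeparable _ Ω
  have h2 : Algebra.FormallyEtale (Algebra.adjoin E (Set.range ((↑) : t → Ω)))
      (IntermediateField.adjoin E (Set.range ((↑) : t → Ω))) :=
    .of_isLocalization (nonZeroDivisors _)
  have h3 : Algebra.FormallyEtale (Algebra.adjoin E (Set.range ((↑) : t → Ω))) Ω :=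
    .comp _ (IntermediateField.adjoin E (Set.range ((↑) : t → Ω))) _
  classical
  let A := Algebra.adjoin E (Set.range ((↑) : t → Ω))
  let e : MvPolynomial t E ≃ₐ[E] A := hb.1.aevalEquiv
  let d : Derivation E A Ω := Derivation.mk' 
    ((IsScalarTower.toAlgHom E A Ω).toLinearMap ∘ₗ e.toLinearMap ∘ₗ 
      (MvPolynomial.pderiv (R := E) (⟨x, hxt'⟩ : t)).toLinearMap ∘ₗ e.symm.toLinearMap) (by
      intro a b
      simp [Algebra.smul_def, Derivation.leibniz]
      )
  let L : TensorProduct A Ω Ω[A⁄E] →ₗ[Ω] Ω := LinearMap.liftBaseChange Ω d.liftKaehlerDifferential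
  let D : Derivation E Ω Ω :=
    (L ∘ₗ (KaehlerDifferential.tensorKaehlerEquivOfFormallyEtale E A Ω).symm.toLinearMap).compDer
      (KaehlerDifferential.D E Ω)
  refine ⟨D, ?_⟩
  have hxA : x = algebraMap A Ω (e (MvPolynomial.X ⟨x, hxt'⟩)) := by
    simp [e, A]
  rw [hxA]
  have key := congrArg L
    (KaehlerDifferential.tensorKaehlerEquivOfFormallyEtale_symm_D_algebraMap E A Ω
      (e (MvPolynomial.X ⟨x, hxt'⟩)))
  have h : D (algebraMap A Ω (e (MvPolynomial.X ⟨x, hxt'⟩))) = 1 := by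
    refine Eq.trans key ?_
    simp [L, d]
  rw [h]
  exact one_ne_zero

theorem exists_derivation_of_notMem_closure {k Ω : Type*} [Field k] [Field Ω] [Algebra k Ω]
    [CharZero k] {S : Set Ω} {x : Ω}
    (hx : x ∉ (AlgebraicIndependent.matroid k Ω).closure S) :
    ∃ D : Derivation k Ω Ω, (∀ s ∈ S, D s = 0) ∧ D x ≠ 0 := by
  rw [mem_closure_iff_isAlgebraic] at hx
  obtain ⟨D, hD⟩ := exists_derivation_ne_zero_of_transcendental hx
  refine ⟨D.restrictScalars k, fun s hs => ?_, hD⟩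
  exact D.map_algebraMap (⟨s, IntermediateField.subset_adjoin k S hs⟩ :
    IntermediateField.adjoin k S)

/-! ### Rank-one gluing of determinants, minors and coprimality -/

section Determinants

variable {m n R : Type*} [Fintype m] [DecidableEq m] [Fintype n] [DecidableEq n] [CommRing R]

theorem Matrix.det_sub_smul_vecMulVec_of_isUnit (M : Matrix m m R) (hM : IsUnit M.det)
    (s : R) (u w : m → R) :
    (M - s • Matrix.vecMulVec u w).det = M.det - s * (w ⬝ᵥ M.adjugate.mulVec u) := by
  have h1 : M - s • Matrix.vecMulVec u w =
      M + Matrix.replicateCol Unit (-s • u) * Matrix.replicateRow Unit w := by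
    ext i j
    simp [Matrix.vecMulVec_apply, Matrix.mul_apply, sub_eq_add_neg, mul_assoc]
  rw [h1, Matrix.det_add_replicateCol_mul_replicateRow hM]
  have h2 : M.adjugate = M.det • M⁻¹ := by
    rw [Matrix.inv_def, smul_smul, Ring.mul_inverse_cancel _ hM, one_smul]
  have h3 : (1 + Matrix.replicateRow Unit w * M⁻¹ * Matrix.replicateCol Unit (-s • u)).det =
      1 - s * (w ⬝ᵥ M⁻¹.mulVec u) := by
    rw [Matrix.mul_assoc, ← Matrix.replicateCol_mulVec, Matrix.det_unique, Matrix.add_apply,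
      Matrix.one_apply_eq, Matrix.replicateRow_mul_replicateCol_apply, Matrix.mulVec_smul,
      dotProduct_smul, smul_eq_mul]
    ring
  rw [h3, h2, Matrix.smul_mulVec, dotProduct_smul, smul_eq_mul]
  ring

theorem RingHom.map_dotProduct_adjugate_mulVec {S : Type*} [CommRing S] (φ : R →+* S)
    (A : Matrix m m R) (u w : m → R) :
    φ (w ⬝ᵥ A.adjugate.mulVec u) = (φ ∘ w) ⬝ᵥ (A.map φ).adjugate.mulVec (φ ∘ u) := by
  rw [← RingHom.mapMatrix_apply, ← RingHom.map_adjugate, RingHom.map_dotProduct]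
  congr 1
  ext i
  exact RingHom.map_mulVec φ _ _ i

/-- Over the fraction field, the Schur complement of `D` is a rank-one update of `M`. -/
theorem Matrix.det_fromBlocks_vecMulVec [IsDomain R] (M : Matrix m m R) (D : Matrix n n R)
    (hM : M.det ≠ 0) (hD : D.det ≠ 0) (u w : m → R) (b c : n → R) :
    (Matrix.fromBlocks M (Matrix.vecMulVec u b) (Matrix.vecMulVec c w) D).det =
      D.det * M.det - (b ⬝ᵥ D.adjugate.mulVec c) * (w ⬝ᵥ M.adjugate.mulVec u) := by
  let K := FractionRing R
  let φ := algebraMap R K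
  have hφ : Function.Injective φ := IsFractionRing.injective R K
  apply hφ
  have hM' : IsUnit (M.map φ).det := by
    rw [← RingHom.mapMatrix_apply, ← RingHom.map_det]
    exact (isUnit_iff_ne_zero.2 (by simpa using (map_ne_zero_iff φ hφ).2 hM))
  have hD' : IsUnit (D.map φ).det := by
    rw [← RingHom.mapMatrix_apply, ← RingHom.map_det]
    exact (isUnit_iff_ne_zero.2 (by simpa using (map_ne_zero_iff φ hφ).2 hD))
  have hv : (Matrix.vecMulVec u b).map φ = Matrix.vecMulVec (φ ∘ u) (φ ∘ b) := by
    ext; simp [Matrix.vecMulVec_apply]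
  have hv' : (Matrix.vecMulVec c w).map φ = Matrix.vecMulVec (φ ∘ c) (φ ∘ w) := by
    ext; simp [Matrix.vecMulVec_apply]
  rw [RingHom.map_det, map_sub, map_mul, map_mul, φ.map_dotProduct_adjugate_mulVec,
    φ.map_dotProduct_adjugate_mulVec, RingHom.map_det, RingHom.map_det]
  simp only [RingHom.mapMatrix_apply, Matrix.fromBlocks_map, hv, hv']
  have := (D.map φ).invertibleOfIsUnitDet hD'
  rw [Matrix.det_fromBlocks₂₂]
  have h1 : Matrix.vecMulVec (φ ∘ u) (φ ∘ b) * ⅟(D.map φ) * Matrix.vecMulVec (φ ∘ c) (φ ∘ w) =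
      ((φ ∘ b) ⬝ᵥ (D.map φ)⁻¹.mulVec (φ ∘ c)) • Matrix.vecMulVec (φ ∘ u) (φ ∘ w) := by
    rw [Matrix.invOf_eq_nonsing_inv, Matrix.mul_assoc, Matrix.mul_vecMulVec,
      Matrix.vecMulVec_mul_vecMulVec]
    ext; simp [Matrix.vecMulVec_apply]; try ring
  rw [h1, Matrix.det_sub_smul_vecMulVec_of_isUnit _ hM']
  have h2 : (D.map φ).adjugate = (D.map φ).det • (D.map φ)⁻¹ := by
    rw [Matrix.inv_def, smul_smul, Ring.mul_inverse_cancel _ hD', one_smul]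
  rw [h2, Matrix.smul_mulVec, dotProduct_smul, smul_eq_mul]
  ring

/-- The bilinear form `bᵀ adj(x - A) c`. -/
noncomputable def Matrix.adjForm (A : Matrix m m R) (b c : m → R) : R[X] :=
  (fun i => C (b i)) ⬝ᵥ A.charmatrix.adjugate.mulVec (fun i => C (c i))

theorem Matrix.charpoly_fromBlocks_vecMulVec [IsDomain R] (A : Matrix m m R) (D : Matrix n n R)
    (u w : m → R) (b c : n → R) :
    (Matrix.fromBlocks A (Matrix.vecMulVec u b) (Matrix.vecMulVec c w) D).charpoly =
      D.charpoly * A.charpoly - D.adjForm b c * A.adjForm w u := by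
  have hb : Matrix.charmatrix (Matrix.fromBlocks A (Matrix.vecMulVec u b)
      (Matrix.vecMulVec c w) D) = Matrix.fromBlocks A.charmatrix
      (Matrix.vecMulVec (fun i => C (u i)) (fun i => - C (b i)))
      (Matrix.vecMulVec (fun i => - C (c i)) (fun i => C (w i))) D.charmatrix := by
    rw [Matrix.charmatrix_fromBlocks]
    have h1 : -(Matrix.vecMulVec u b).map C =
        Matrix.vecMulVec (fun i => C (u i)) (fun i => - C (b i)) := by
      ext i j : 1
      simp only [Matrix.neg_apply, Matrix.map_apply, Matrix.vecMulVec_apply, C_mul, mul_neg]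
    have h2 : -(Matrix.vecMulVec c w).map C =
        Matrix.vecMulVec (fun i => - C (c i)) (fun i => C (w i)) := by
      ext i j : 1
      simp only [Matrix.neg_apply, Matrix.map_apply, Matrix.vecMulVec_apply, C_mul, neg_mul]
    rw [h1, h2]
  rw [Matrix.charpoly, hb, Matrix.det_fromBlocks_vecMulVec]
  · have h3 : (fun i => - C (b i)) ⬝ᵥ D.charmatrix.adjugate.mulVec (fun i => - C (c i)) =
        D.adjForm b c := by
      change (-fun i => C (b i)) ⬝ᵥ D.charmatrix.adjugate.mulVec (-fun i => C (c i)) = _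
      rw [Matrix.mulVec_neg, neg_dotProduct_neg]; rfl
    rw [h3]; rfl
  · exact A.charpoly_monic.ne_zero
  · exact D.charpoly_monic.ne_zero

theorem Matrix.det_submatrix_ne (M : Matrix m m R) (r : m) {p : m → Prop} [DecidablePred p]
    (hp : ∀ i, p i ↔ i ≠ r) :
    (M.submatrix (Subtype.val : {i // p i} → m) Subtype.val).det = M.adjugate r r := by
  rw [Matrix.adjugate_apply, Matrix.twoBlockTriangular_det _ p]
  · have h1 : (M.updateRow r (Pi.single r 1)).toSquareBlockProp p =
        M.submatrix Subtype.val Subtype.val := by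
      ext i j
      simp [Matrix.toSquareBlockProp, Matrix.updateRow_ne ((hp i).1 i.2)]
    have h2 : ((M.updateRow r (Pi.single r 1)).toSquareBlockProp (fun i => ¬ p i)) = 1 := by
      ext i j
      have hi : (i : m) = r := not_not.1 fun h => i.2 ((hp i).2 h)
      have hj : (j : m) = r := not_not.1 fun h => j.2 ((hp j).2 h)
      have : i = j := Subtype.ext (hi.trans hj.symm)
      subst this
      simp [Matrix.toSquareBlockProp, hi]
    rw [h1, h2, Matrix.det_one, mul_one]
  · intro i hi j hj
    have hi' : i = r := not_not.1 fun h => hi ((hp i).2 h)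
    rw [hi', Matrix.updateRow_self, Pi.single_eq_of_ne ((hp j).1 hj)]

/-- Jacobi's identity for 2 × 2 minors of the adjugate. The indicator form also covers `v = r`,
where the minor of the submatrix reads as zero. -/
theorem Matrix.det_mul_adjugate_submatrix_ne [IsDomain R] (M : Matrix m m R) (r v : m)
    {p : m → Prop} [DecidablePred p] (hp : ∀ i, p i ↔ i ≠ r)
    (hr : M.adjugate r r ≠ 0) :
    M.det * ((fun i : {i // p i} => if (i : m) = v then (1 : R) else 0) ⬝ᵥ
      (M.submatrix (Subtype.val : {i // p i} → m) Subtype.val).adjugate.mulVec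
        (fun i => if (i : m) = v then 1 else 0)) - M.adjugate v v * M.adjugate r r =
      - (M.adjugate r v * M.adjugate v r) := by
  by_cases hv : v = r
  · subst hv
    have : (fun i : {i // p i} => if (i : m) = v then (1 : R) else 0) = 0 := by
      ext i; simp [(hp i).1 i.2]
    rw [this]; simp
  set N := M.submatrix (Subtype.val : {i // p i} → m) Subtype.val with hN
  have hNd : N.det = M.adjugate r r := M.det_submatrix_ne r hp
  set v' : {i // p i} := ⟨v, (hp v).2 hv⟩
  have hvec : (fun i : {i // p i} => if (i : m) = v then (1 : R) else 0) = Pi.single v' 1 := by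
    ext i
    simp [Pi.single_apply, Subtype.ext_iff, v']
  rw [hvec, Matrix.mulVec_single_one, single_one_dotProduct, Matrix.col_apply]
  -- A multiple of the inverse of `N`: the Schur complement of the `(r, r)` entry in the inverse of
  -- `M`, with denominators cleared.
  let S : Matrix {i // p i} {i // p i} R := fun i j =>
    M.adjugate r r * M.adjugate i j - M.adjugate i r * M.adjugate r j
  have hmul : ∀ i j, ∑ l, M i l * M.adjugate l j = if i = j then M.det else 0 := by
    intro i j
    have := congrFun (congrFun M.mul_adjugate i) j
    rw [Matrix.mul_apply] at this
    rw [this, Matrix.smul_apply, Matrix.one_apply]; simp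
  have hNS : N * S = (M.det * M.adjugate r r) • (1 : Matrix {i // p i} {i // p i} R) := by
    ext i j
    have hsum : ∑ l : {i // p i}, M i l * (M.adjugate r r * M.adjugate l j -
        M.adjugate l r * M.adjugate r j) = ∑ l, M i l * (M.adjugate r r * M.adjugate l j -
        M.adjugate l r * M.adjugate r j) := by
      have h := Finset.sum_subtype (F := Subtype.fintype _) (Finset.univ.erase r) (p := p)
        (by simp [hp])
        (fun l => M i l * (M.adjugate r r * M.adjugate l j - M.adjugate l r * M.adjugate r j))
      rw [← h]
      exact Finset.sum_erase _ (by ring)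
    rw [Matrix.mul_apply]
    change ∑ l : {i // p i}, M i l * (M.adjugate r r * M.adjugate l j -
        M.adjugate l r * M.adjugate r j) = _
    rw [hsum]
    have : ∑ l, M i l * (M.adjugate r r * M.adjugate l j - M.adjugate l r * M.adjugate r j) =
        M.adjugate r r * ∑ l, M i l * M.adjugate l j -
          (∑ l, M i l * M.adjugate l r) * M.adjugate r j := by
      rw [Finset.mul_sum, Finset.sum_mul, ← Finset.sum_sub_distrib]
      exact Finset.sum_congr rfl fun l _ => by ring
    rw [this, hmul, hmul, if_neg ((hp i).1 i.2), Matrix.smul_apply, Matrix.one_apply]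
    simp only [Subtype.ext_iff]
    split_ifs <;> simp [mul_comm]
  have hadj : N.det • S = (M.det * M.adjugate r r) • N.adjugate := by
    have := congrArg (fun X => N.adjugate * X) hNS
    simp only [← Matrix.mul_assoc, Matrix.adjugate_mul, Matrix.smul_mul, Matrix.one_mul,
      Matrix.mul_smul, Matrix.mul_one] at this
    exact this
  have h1 : N.det * (M.adjugate r r * M.adjugate v v - M.adjugate v r * M.adjugate r v) =
      M.det * M.adjugate r r * N.adjugate v' v' := congrFun (congrFun hadj v') v'
  rw [hNd] at h1
  have h2 : M.adjugate r r * (M.adjugate r r * M.adjugate v v - M.adjugate v r * M.adjugate r v) =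
    M.adjugate r r * (M.det * N.adjugate v' v') := by rw [h1]; ring
  have h3 := mul_left_cancel₀ hr h2
  rw [← h3]; ring

/-- Conjugation by an invertible diagonal matrix preserves the characteristic polynomial and the
diagonal minors of `x - A`. -/
theorem Matrix.charmatrix_adjugate_of_conj {K : Type*} [Field K] {A B : Matrix m m K} {s : m → K}
    (hs : ∀ i, s i ≠ 0) (h : ∀ i j, B i j = (s i)⁻¹ * A i j * s j) :
    B.charpoly = A.charpoly ∧ ∀ i, B.charmatrix.adjugate i i = A.charmatrix.adjugate i i := by
  have e1 : B.charmatrix = Matrix.diagonal (fun i => C (s i)⁻¹) * A.charmatrix *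
      Matrix.diagonal (fun i => C (s i)) := by
    ext i j : 1
    rw [Matrix.mul_diagonal, Matrix.diagonal_mul, Matrix.charmatrix_apply, Matrix.charmatrix_apply,
      h]
    by_cases hij : i = j
    · subst hij
      have h1 : C (s i)⁻¹ * C (s i) = (1 : K[X]) := by
        rw [← C_mul, inv_mul_cancel₀ (hs i), C_1]
      rw [Matrix.diagonal_apply_eq, C_mul, C_mul]
      linear_combination (-X : K[X]) * h1
    · rw [Matrix.diagonal_apply_ne _ hij, C_mul, C_mul]; ring
  have e2 : Matrix.diagonal (fun i => C (s i)⁻¹) * Matrix.diagonal (fun i => C (s i)) =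
      (1 : Matrix m m K[X]) := by
    rw [Matrix.diagonal_mul_diagonal, ← Matrix.diagonal_one]
    congr 1; ext i : 1
    rw [← C_mul, inv_mul_cancel₀ (hs i)]; rfl
  constructor
  · rw [Matrix.charpoly, e1, Matrix.det_mul, Matrix.det_mul, mul_right_comm, ← Matrix.det_mul, e2,
      Matrix.det_one, one_mul]; rfl
  · intro i
    have e3 : B.charmatrix.adjugate = Matrix.diagonal (fun i => C (s i)⁻¹) *
        A.charmatrix.adjugate * Matrix.diagonal (fun i => C (s i)) := by
      have hdet := congrArg Matrix.det e2
      rw [Matrix.det_mul, Matrix.det_one] at hdet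
      have ha : ∀ {P Q : Matrix m m K[X]}, P * Q = 1 → P.det * Q.det = 1 →
          Q.adjugate = Q.det • P := by
        intro P Q h1 _
        rw [← Matrix.one_mul Q.adjugate, ← h1, Matrix.mul_assoc, Matrix.mul_adjugate,
          Matrix.mul_smul, Matrix.mul_one]
      have e2' := mul_eq_one_comm.1 e2
      rw [e1, Matrix.adjugate_mul_distrib, Matrix.adjugate_mul_distrib, ha e2 hdet,
        ha e2' (by rwa [mul_comm]), Matrix.mul_smul, Matrix.mul_smul, Matrix.smul_mul, smul_smul,
        hdet, one_smul, Matrix.mul_assoc]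
    rw [e3, Matrix.mul_diagonal, Matrix.diagonal_mul, mul_right_comm, ← C_mul,
      inv_mul_cancel₀ (hs i), C_1, one_mul]

/-- For a tree matrix, `x - A` sends an explicit vector of powers of `x` to a multiple of the basis
vector at `r`. Applying the adjugate shows that its column `r` is nonzero everywhere. -/
theorem Matrix.adjugate_charmatrix_ne_zero_of_tree [Nontrivial R] (A : Matrix m m R)
    (r : m) (p : m → m) (d : m → ℕ)
    (hp : ∀ i, i ≠ r → d i = d (p i) + 1) (hr : d r = 0)
    (hA : ∀ i j, A i j = if i ≠ r ∧ j = p i then 1 else 0) (a : m) :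
    A.charmatrix.adjugate a r ≠ 0 := by
  obtain ⟨N, hN⟩ : ∃ N, ∀ i, d i ≤ N := ⟨∑ i, d i, fun i =>
    Finset.single_le_sum (f := d) (fun _ _ => Nat.zero_le _) (Finset.mem_univ i)⟩
  let z : m → R[X] := fun i => X ^ (N - d i)
  have hz : A.charmatrix.mulVec z = Pi.single r (X ^ (N + 1)) := by
    ext i : 1
    rw [Matrix.mulVec, dotProduct]
    simp only [Matrix.charmatrix_apply, sub_mul, Finset.sum_sub_distrib, hA]
    by_cases hi : i = r
    · subst hi
      simp [Matrix.diagonal_apply, z, hr, pow_succ']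
    · have := hp i hi
      have h2 := hN i
      simp [Matrix.diagonal_apply, z, hi]
      rw [← pow_succ', show N - d i + 1 = N - d (p i) by omega, sub_self]
  have h1 := congrArg (A.charmatrix.adjugate.mulVec) hz
  rw [Matrix.mulVec_mulVec, Matrix.adjugate_mul, Matrix.smul_mulVec, Matrix.one_mulVec] at h1
  have h2 := congrFun h1 a
  intro h0
  simp [Matrix.mulVec, dotProduct, Pi.single_apply, h0, z] at h2
  have h3 : (A.charpoly * X ^ (N - d a)).Monic := A.charpoly_monic.mul (monic_X_pow _)
  exact h3.ne_zero h2

theorem Matrix.aeval_map_map {S : Type*} [CommRing S] (φ : R →+* S) (D : Matrix m m R)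
    (W : R[X]) : aeval (D.map φ) (W.map φ) = φ.mapMatrix (aeval D W) := by
  have := Polynomial.hom_eval₂ W (algebraMap R (Matrix m m R)) φ.mapMatrix D
  rw [aeval_def, eval₂_map, aeval_def, this]
  congr 1
  ext a i j
  simp [Matrix.algebraMap_matrix_apply, apply_ite φ]

theorem Matrix.map_adjugate_charmatrix {S : Type*} [CommRing S] (φ : R →+* S) (A : Matrix m m R)
    (i j : m) : (A.charmatrix.adjugate i j).map φ = (A.map φ).charmatrix.adjugate i j := by
  rw [Matrix.charmatrix_map]
  exact congrFun (congrFun ((Polynomial.mapRingHom φ).map_adjugate A.charmatrix) i) j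

theorem Matrix.map_adjForm {S : Type*} [CommRing S] (φ : R →+* S) (A : Matrix m m R)
    (b c : m → R) : (A.adjForm b c).map φ = (A.map φ).adjForm (φ ∘ b) (φ ∘ c) := by
  simp only [Matrix.adjForm, dotProduct, Matrix.mulVec, Polynomial.map_sum, Polynomial.map_mul,
    Polynomial.map_C, Matrix.map_adjugate_charmatrix, Function.comp]

/-- A common root y in an extension field would make `D - y` a singular factor of `W(D)`. -/
theorem Matrix.isCoprime_charpoly_of_det_aeval_ne_zero {K : Type*} [Field K] (D : Matrix m m K)
    (W : K[X]) (h : (aeval D W).det ≠ 0) : IsCoprime W D.charpoly := by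
  by_contra hc
  rw [isCoprime_iff_aeval_ne_zero] at hc
  push Not at hc
  obtain ⟨L, _, _, _, y, hy1, hy2⟩ := hc
  let φ := algebraMap K L
  have h1 : (aeval (D.map φ) (W.map φ)).det ≠ 0 := by
    rw [Matrix.aeval_map_map, ← RingHom.map_det]
    exact (map_ne_zero_iff φ (FaithfulSMul.algebraMap_injective K L)).2 h
  apply h1
  have hdvd : X - C y ∣ W.map φ := by
    rw [dvd_iff_isRoot, IsRoot, eval_map_algebraMap]; exact hy1
  obtain ⟨q, hq⟩ := hdvd
  rw [hq, map_mul, Matrix.det_mul]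
  have : (aeval (D.map φ) (X - C y)).det = 0 := by
    have h2 : (Matrix.scalar m y - D.map φ).det = 0 := by
      rw [← Matrix.eval_charpoly, Matrix.charpoly_map, eval_map_algebraMap]; exact hy2
    have h3 : aeval (D.map φ) (X - C y) = -(Matrix.scalar m y - D.map φ) := by
      simp [Matrix.algebraMap_eq_diagonal]
    rw [h3, Matrix.det_neg, h2, mul_zero]
  rw [this, zero_mul]

end Determinants

/-! ### Generic matrices: expected dimension as a matroid rank -/

namespace CompartmentGraph

variable {V : Type*} [DecidableEq V]

/-- The matrix of the parameter space with entries prescribed by `x`. -/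
def mat (G : CompartmentGraph V) {S : Type*} [Zero S] (x : V × V → S) :
    Matrix G.verts G.verts S :=
  fun i j => if i = j ∨ ((j : V), (i : V)) ∈ G.edges then x (i, j) else 0

theorem mat_map (G : CompartmentGraph V) {S T : Type*} [Zero S] [Zero T] (x : V × V → S)
    (f : S → T) (hf : f 0 = 0) : (G.mat x).map f = G.mat (f ∘ x) := by
  ext i j
  simp only [Matrix.map_apply, mat, Function.comp]
  split_ifs <;> simp [hf]

theorem mat_congr (G : CompartmentGraph V) {S : Type*} [Zero S] {x y : V × V → S}
    (h : ∀ i ∈ G.verts, ∀ j ∈ G.verts, x (i, j) = y (i, j)) : G.mat x = G.mat y := by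
  ext i j
  simp only [mat, h i i.2 j j.2]

theorem mat_mem_parameterSpace (G : CompartmentGraph V) {k : Type*} [Field k] (x : V × V → k) :
    G.mat x ∈ G.parameterSpace k := by
  intro i j hij he
  simp [mat, hij, he]

theorem exists_eq_mat (G : CompartmentGraph V) {k : Type*} [Field k]
    {A : Matrix G.verts G.verts k} (hA : A ∈ G.parameterSpace k) : ∃ x, A = G.mat x := by
  refine ⟨fun e => if h : e.1 ∈ G.verts ∧ e.2 ∈ G.verts then A ⟨e.1, h.1⟩ ⟨e.2, h.2⟩ else 0, ?_⟩
  ext i j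
  simp only [mat]
  split_ifs with h h2
  · rfl
  · exact absurd ⟨i.2, j.2⟩ h2
  · push Not at h
    exact hA i j h.1 h.2

/-- The family of coefficients listed by `doubleCharpoly`, over a commutative ring. -/
noncomputable def coeffFamily {S : Type*} [CommRing S] (G : CompartmentGraph V) (r : V)
    (A : Matrix G.verts G.verts S) : Fin G.verts.card ⊕ Fin (G.verts.card - 1) → S :=
  Sum.elim (fun k => A.charpoly.coeff k) (fun k => (G.deleteVertex r A).charpoly.coeff k)

theorem comp_coeffFamily {S T : Type*} [CommRing S] [CommRing T] (G : CompartmentGraph V) (r : V)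
    (A : Matrix G.verts G.verts S) (f : S →+* T) :
    f ∘ G.coeffFamily r A = G.coeffFamily r (A.map f) := by
  have h : G.deleteVertex r (A.map f) = (G.deleteVertex r A).map f := rfl
  funext i
  rcases i with i | i <;>
    simp [coeffFamily, h, Matrix.charpoly_map]

section Dimension

variable {k : Type*} [Field k]

/-- Over an infinite field, a polynomial in the entries that vanishes at all points is zero. -/
theorem mem_vanishingIdeal_iff_aeval_generic [Infinite k] (G : CompartmentGraph V) (r : V)
    (Q : MvPolynomial (Fin G.verts.card ⊕ Fin (G.verts.card - 1)) k) :
    Q ∈ MvPolynomial.vanishingIdeal k (G.doubleCharpoly k r '' G.parameterSpace k) ↔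
      MvPolynomial.aeval (G.coeffFamily r (G.mat (MvPolynomial.X (R := k)))) Q = 0 := by
  have key : ∀ y : V × V → k, MvPolynomial.aeval (G.doubleCharpoly k r (G.mat y)) Q =
      MvPolynomial.eval y
        (MvPolynomial.aeval (G.coeffFamily r (G.mat (MvPolynomial.X (R := k)))) Q) := by
    intro y
    have h1 : G.doubleCharpoly k r (G.mat y) =
        (MvPolynomial.aeval y : MvPolynomial (V × V) k →ₐ[k] k) ∘
          G.coeffFamily r (G.mat (MvPolynomial.X (R := k))) := by
      have := G.comp_coeffFamily r (G.mat (MvPolynomial.X (R := k)))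
        (MvPolynomial.aeval y : MvPolynomial (V × V) k →ₐ[k] k).toRingHom
      refine Eq.trans ?_ this.symm
      rw [mat_map _ _ _ (map_zero _)]
      change G.coeffFamily r (G.mat y) = _
      congr 2
      funext e
      simp
    rw [h1, ← MvPolynomial.aeval_eq_eval]
    exact (DFunLike.congr_fun (MvPolynomial.comp_aeval _ _) Q).symm
  rw [MvPolynomial.mem_vanishingIdeal_iff]
  constructor
  · intro h
    refine MvPolynomial.funext fun y => ?_
    rw [← key, map_zero]
    exact h _ ⟨_, G.mat_mem_parameterSpace y, rfl⟩
  · rintro h _ ⟨A, hA, rfl⟩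
    obtain ⟨y, rfl⟩ := G.exists_eq_mat hA
    rw [key, h, map_zero]

variable {Ω : Type*} [Field Ω] [Algebra k Ω]

theorem aeval_coeffFamily (G : CompartmentGraph V) (r : V) (x : V × V → Ω)
    (Q : MvPolynomial (Fin G.verts.card ⊕ Fin (G.verts.card - 1)) k) :
    MvPolynomial.aeval (G.coeffFamily r (G.mat x)) Q = MvPolynomial.aeval x
      (MvPolynomial.aeval (G.coeffFamily r (G.mat (MvPolynomial.X (R := k)))) Q) := by
  have h1 : G.coeffFamily r (G.mat x) =
      (MvPolynomial.aeval x : MvPolynomial (V × V) k →ₐ[k] Ω) ∘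
        G.coeffFamily r (G.mat (MvPolynomial.X (R := k))) := by
    have := G.comp_coeffFamily r (G.mat (MvPolynomial.X (R := k)))
      (MvPolynomial.aeval x : MvPolynomial (V × V) k →ₐ[k] Ω).toRingHom
    refine Eq.trans ?_ this.symm
    rw [mat_map _ _ _ (map_zero _)]
    congr 2
    funext e
    simp
  rw [h1]
  exact (DFunLike.congr_fun (MvPolynomial.comp_aeval _ _) Q).symm

/-- Evaluation at any point of the parameter space over `Ω` factors through the coordinate ring of
the image, and transcendence degree does not grow under surjections. -/
theorem eRk_range_coeffFamily_le [Infinite k] (G : CompartmentGraph V) (r : V) (x : V × V → Ω) :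
    (AlgebraicIndependent.matroid k Ω).eRk (Set.range (G.coeffFamily r (G.mat x))) ≤
      Cardinal.toENat (zariskiDim (G.doubleCharpoly k r '' G.parameterSpace k)) := by
  set I := MvPolynomial.vanishingIdeal k (G.doubleCharpoly k r '' G.parameterSpace k) with hI
  have h : ∀ Q ∈ I, MvPolynomial.aeval (G.coeffFamily r (G.mat x)) Q = 0 := by
    intro Q hQ
    rw [hI, mem_vanishingIdeal_iff_aeval_generic] at hQ
    rw [aeval_coeffFamily, hQ, map_zero]
  let f : (MvPolynomial _ k ⧸ I) →ₐ[k] Ω :=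
    Ideal.Quotient.liftₐ I (MvPolynomial.aeval (G.coeffFamily r (G.mat x))) h
  have hf : f.range = Algebra.adjoin k (Set.range (G.coeffFamily r (G.mat x))) := by
    rw [Algebra.adjoin_range_eq_range_aeval]
    ext y
    constructor
    · rintro ⟨q, rfl⟩
      obtain ⟨Q, rfl⟩ := Ideal.Quotient.mk_surjective q
      exact ⟨Q, rfl⟩
    · rintro ⟨Q, rfl⟩
      exact ⟨Ideal.Quotient.mk I Q, rfl⟩
  rw [← toENat_trdeg_adjoin, ← hf]
  have := lift_trdeg_le_of_surjective f.rangeRestrict f.rangeRestrict_surjective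
  have h2 := Cardinal.toENat.monotone' this
  simpa [zariskiDim] using h2

/-- At a generic point this evaluation is also injective. -/
theorem eRk_range_coeffFamily_eq [Infinite k] (G : CompartmentGraph V) (r : V) {x : V × V → Ω}
    (hx : AlgebraicIndependent k x) :
    (AlgebraicIndependent.matroid k Ω).eRk (Set.range (G.coeffFamily r (G.mat x))) =
      Cardinal.toENat (zariskiDim (G.doubleCharpoly k r '' G.parameterSpace k)) := by
  refine le_antisymm (eRk_range_coeffFamily_le G r x) ?_
  set I := MvPolynomial.vanishingIdeal k (G.doubleCharpoly k r '' G.parameterSpace k) with hI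
  have h : ∀ Q, Q ∈ I ↔ MvPolynomial.aeval (G.coeffFamily r (G.mat x)) Q = 0 := by
    intro Q
    rw [hI, mem_vanishingIdeal_iff_aeval_generic, aeval_coeffFamily]
    exact (map_eq_zero_iff _ hx).symm
  let f : (MvPolynomial _ k ⧸ I) →ₐ[k] Ω :=
    Ideal.Quotient.liftₐ I (MvPolynomial.aeval (G.coeffFamily r (G.mat x))) (fun Q => (h Q).1)
  have hf : f.range ≤ Algebra.adjoin k (Set.range (G.coeffFamily r (G.mat x))) := by
    rw [Algebra.adjoin_range_eq_range_aeval]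
    rintro _ ⟨q, rfl⟩
    obtain ⟨Q, rfl⟩ := Ideal.Quotient.mk_surjective q
    exact ⟨Q, rfl⟩
  let g := (Subalgebra.inclusion hf).comp f.rangeRestrict
  have hg : Function.Injective g := by
    rw [injective_iff_map_eq_zero]
    intro q hq
    obtain ⟨Q, rfl⟩ := Ideal.Quotient.mk_surjective q
    rw [Ideal.Quotient.eq_zero_iff_mem, h]
    exact congrArg Subtype.val hq
  rw [← toENat_trdeg_adjoin]
  have := lift_trdeg_le_of_injective g hg
  have h2 := Cardinal.toENat.monotone' this
  simpa [zariskiDim] using h2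

/-- All coefficients of both characteristic polynomials. -/
def coeffSet {S : Type*} [CommRing S] (G : CompartmentGraph V) (r : V)
    (A : Matrix G.verts G.verts S) : Set S :=
  Set.range A.charpoly.coeff ∪ Set.range (G.deleteVertex r A).charpoly.coeff

/-- The extra coefficients are only 0 and the leading 1, which add no rank. -/
theorem eRk_coeffSet (G : CompartmentGraph V) {r : V} (hr : r ∈ G.verts)
    (A : Matrix G.verts G.verts Ω) :
    (AlgebraicIndependent.matroid k Ω).eRk (G.coeffSet r A) =
      (AlgebraicIndependent.matroid k Ω).eRk (Set.range (G.coeffFamily r A)) := by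
  apply le_antisymm
  · rw [← Matroid.eRk_closure_eq _ (Set.range (G.coeffFamily r A))]
    apply Matroid.eRk_mono
    have hsub : ∀ i, G.coeffFamily r A i ∈ algClosureOf k (Set.range (G.coeffFamily r A)) := by
      intro i
      rw [mem_algClosureOf]
      exact Matroid.mem_closure_of_mem _ ⟨i, rfl⟩
    have hmonic : ∀ (P : Polynomial Ω) (n : ℕ), P.Monic → P.natDegree = n →
        (∀ j : Fin n, P.coeff j ∈ algClosureOf k (Set.range (G.coeffFamily r A))) →
        ∀ j, P.coeff j ∈ algClosureOf k (Set.range (G.coeffFamily r A)) := by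
      intro P n hP hn h j
      rcases lt_trichotomy j n with hj | hj | hj
      · exact h ⟨j, hj⟩
      · rw [hj, ← hn, hP.coeff_natDegree]; exact one_mem _
      · rw [coeff_eq_zero_of_natDegree_lt (by omega)]; exact zero_mem _
    rintro _ (⟨j, rfl⟩ | ⟨j, rfl⟩)
    · rw [← mem_algClosureOf]
      refine hmonic _ _ A.charpoly_monic (A.charpoly_natDegree_eq_dim) (fun j => ?_) j
      exact hsub (Sum.inl (Fin.cast (by simp) j))
    · rw [← mem_algClosureOf]
      refine hmonic _ _ (Matrix.charpoly_monic _) (Matrix.charpoly_natDegree_eq_dim _)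
        (fun j => ?_) j
      have hc : Fintype.card {i : G.verts // (i : V) ≠ r} = G.verts.card - 1 := by
        have := Fintype.card_subtype_compl (fun i : G.verts => (i : V) = r)
        rw [Fintype.card_coe] at this
        rw [this]
        congr 1
        rw [Fintype.card_eq_one_iff]
        exact ⟨⟨⟨r, hr⟩, rfl⟩, fun y => Subtype.ext (Subtype.ext y.2)⟩
      exact hsub (Sum.inr (Fin.cast hc j))
  · apply Matroid.eRk_mono
    rintro _ ⟨i | i, rfl⟩
    · exact Or.inl ⟨_, rfl⟩
    · exact Or.inr ⟨_, rfl⟩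

theorem hasExpectedDimension_iff [Infinite k] (G : CompartmentGraph V) {r : V} (hr : r ∈ G.verts)
    {x : V × V → Ω} (hx : AlgebraicIndependent k x) :
    G.HasExpectedDimension k r ↔
      (AlgebraicIndependent.matroid k Ω).eRk (G.coeffSet r (G.mat x)) =
        ((G.edges.card + 1 : ℕ) : ℕ∞) := by
  rw [eRk_coeffSet G hr, eRk_range_coeffFamily_eq G r hx, Cardinal.toENat_eq_natCast]
  rfl

theorem eRk_coeffSet_le [Infinite k] (G : CompartmentGraph V) {r : V} (hr : r ∈ G.verts)
    {x : V × V → Ω} (hx : AlgebraicIndependent k x) (y : V × V → Ω) :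
    (AlgebraicIndependent.matroid k Ω).eRk (G.coeffSet r (G.mat y)) ≤
      (AlgebraicIndependent.matroid k Ω).eRk (G.coeffSet r (G.mat x)) := by
  rw [eRk_coeffSet G hr, eRk_coeffSet G hr, eRk_range_coeffFamily_eq G r hx]
  exact eRk_range_coeffFamily_le G r y

end Dimension

end CompartmentGraph

/-! ### Upper bound: normalising a spanning tree -/

section CoefficientFields

variable {k Ω ι : Type*} [Field k] [Field Ω] [Algebra k Ω] [Fintype ι] [DecidableEq ι]

theorem Matrix.coeff_charpoly_mem (F : IntermediateField k Ω) {B : Matrix ι ι Ω}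
    (hB : ∀ i j, B i j ∈ F) (n : ℕ) : B.charpoly.coeff n ∈ F := by
  obtain ⟨B', rfl⟩ : ∃ B' : Matrix ι ι F, B = B'.map (algebraMap F Ω) :=
    ⟨fun i j => ⟨B i j, hB i j⟩, rfl⟩
  rw [Matrix.charpoly_map, coeff_map]
  exact (B'.charpoly.coeff n).2

theorem Matrix.coeff_adjugate_charmatrix_mem (F : IntermediateField k Ω) {B : Matrix ι ι Ω}
    (hB : ∀ i j, B i j ∈ F) (i j : ι) (n : ℕ) : (B.charmatrix.adjugate i j).coeff n ∈ F := by
  obtain ⟨B', rfl⟩ : ∃ B' : Matrix ι ι F, B = B'.map (algebraMap F Ω) :=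
    ⟨fun i j => ⟨B i j, hB i j⟩, rfl⟩
  rw [← Matrix.map_adjugate_charmatrix, coeff_map]
  exact ((B'.charmatrix.adjugate i j).coeff n).2

theorem Matrix.adjForm_indicator {R V : Type*} [CommRing R] [DecidableEq V]
    (A : Matrix ι ι R) (f : ι → V) (hf : Function.Injective f) (v : V) :
    A.adjForm (fun i => if f i = v then 1 else 0) (fun i => if f i = v then 1 else 0) =
      ∑ i, if f i = v then A.charmatrix.adjugate i i else 0 := by
  simp only [Matrix.adjForm, dotProduct, Matrix.mulVec]
  refine Finset.sum_congr rfl fun i _ => ?_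
  by_cases hi : f i = v
  · rw [if_pos hi, if_pos hi, C_1, one_mul, Finset.sum_eq_single i]
    · simp [hi]
    · intro j _ hj
      rw [if_neg (fun h => hj (hf (h.trans hi.symm))), C_0, mul_zero]
    · simp
  · simp [hi]

theorem Matrix.coeff_adjForm_mem (F : IntermediateField k Ω) {B : Matrix ι ι Ω}
    (hB : ∀ i j, B i j ∈ F) {u w : ι → Ω} (hu : ∀ i, u i ∈ F) (hw : ∀ i, w i ∈ F) (n : ℕ) :
    (B.adjForm u w).coeff n ∈ F := by
  simp only [Matrix.adjForm, dotProduct, Matrix.mulVec, finsetSum_coeff, coeff_C_mul, coeff_mul_C]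
  exact sum_mem fun i _ => mul_mem (hu i) (sum_mem fun j _ =>
    mul_mem (Matrix.coeff_adjugate_charmatrix_mem F hB i j n) (hw j))

end CoefficientFields

namespace CompartmentGraph

variable {V : Type*} [DecidableEq V]

theorem StronglyConnected.exists_tree {G : CompartmentGraph V} (hG : G.StronglyConnected) {r : V}
    (hr : r ∈ G.verts) : ∃ (p : V → V) (d : V → ℕ), d r = 0 ∧
      ∀ i ∈ G.verts, i ≠ r → (p i, i) ∈ G.edges ∧ d i = d (p i) + 1 := by
  -- `P n i` means that a walk of length `n` leads from `r` to `i`; `d` is then the distance from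
  -- `r`, and parents come from shortest walks.
  let P : ℕ → V → Prop := fun n => Nat.rec (fun i => i = r)
    (fun _ Q i => ∃ j, Q j ∧ (j, i) ∈ G.edges) n
  have hP : ∀ i ∈ G.verts, ∃ n, P n i := by
    intro i hi
    have := hG r hr i hi
    induction this with
    | refl => exact ⟨0, rfl⟩
    | tail _ h ih =>
      obtain ⟨n, hn⟩ := ih (G.mem_verts _ h).1
      exact ⟨n + 1, _, hn, h⟩
  let d : V → ℕ := fun i => sInf {n | P n i}
  have hd : ∀ n i, P n i → d i ≤ n := fun n i h => Nat.sInf_le h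
  have hdr : d r = 0 := Nat.le_zero.1 (hd 0 r rfl)
  have hex : ∀ i, ∃ j, i ∈ G.verts → i ≠ r → (j, i) ∈ G.edges ∧ d i = d j + 1 := by
    intro i
    by_cases hi : i ∈ G.verts
    · by_cases hir : i = r
      · exact ⟨i, fun _ h => absurd hir h⟩
      have h1 : P (d i) i := Nat.sInf_mem (s := {n | P n i}) (hP i hi)
      obtain ⟨m, hm⟩ : ∃ m, d i = m + 1 := by
        refine Nat.exists_eq_succ_of_ne_zero fun h0 => ?_
        rw [h0] at h1
        exact hir h1
      rw [hm] at h1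
      obtain ⟨j, hj, he⟩ := h1
      refine ⟨j, fun _ _ => ⟨he, le_antisymm ?_ ?_⟩⟩
      · have hj' : P (d j) j := Nat.sInf_mem (s := {n | P n j}) ⟨m, hj⟩
        exact hd (d j + 1) i ⟨j, hj', he⟩
      · rw [hm]
        exact Nat.succ_le_succ (hd m j hj)
    · exact ⟨i, fun h => absurd h hi⟩
  choose p hp using hex
  exact ⟨p, d, hdr, hp⟩

section Upper

variable {k Ω : Type*} [Field k] [Field Ω] [Algebra k Ω]

theorem StronglyConnected.exists_conj {G : CompartmentGraph V} (hG : G.StronglyConnected) {v : V}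
    (hv : v ∈ G.verts) {x : V × V → Ω} (hx : ∀ e, x e ≠ 0) :
    ∃ T : Set Ω, T.encard ≤ G.edges.card ∧ ∃ s : G.verts → Ω, (∀ i, s i ≠ 0) ∧
      ∀ i j, (s i)⁻¹ * G.mat x i j * s j ∈ algClosureOf k (insert (x (v, v)) T) := by
  obtain ⟨p, d, hdv, hp⟩ := hG.exists_tree hv
  -- The product of the entries along the tree path between `v` and `i`, so that conjugation makes
  -- every tree entry 1.
  let s : V → Ω := fun i => ∏ t ∈ Finset.range (d i), x (p^[t] i, p^[t + 1] i)
  have hs : ∀ i, s i ≠ 0 := fun i => Finset.prod_ne_zero_iff.2 fun t _ => hx _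
  have hs' : ∀ i ∈ G.verts, i ≠ v → s i = x (i, p i) * s (p i) := by
    intro i hi hiv
    simp only [s, (hp i hi hiv).2, Finset.prod_range_succ', Function.iterate_succ,
      Function.comp, Function.iterate_zero, id]
    rw [mul_comm]
  -- One generator per edge: the slot freed by the tree edge into `i` stores the diagonal entry at
  -- `i`. Only the diagonal entry at `v` is left over.
  let φ : V × V → Ω := fun e => if e.2 ≠ v ∧ e.1 = p e.2 then x (e.2, e.2)
    else (s e.2)⁻¹ * x (e.2, e.1) * s e.1
  refine ⟨φ '' G.edges, (Set.encard_image_le _ _).trans_eq (Set.encard_coe_eq_coe_finsetCard _),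
    fun i => s i, fun i => hs i, fun i j => ?_⟩
  have hmem : ∀ y ∈ insert (x (v, v)) (φ '' G.edges),
      y ∈ algClosureOf k (insert (x (v, v)) (φ '' G.edges)) := fun y hy =>
    mem_algClosureOf.2 (Matroid.mem_closure_of_mem _ hy)
  by_cases hij : i = j
  · subst hij
    rw [mat, if_pos (Or.inl rfl), mul_right_comm, inv_mul_cancel₀ (hs i), one_mul]
    by_cases hiv : (i : V) = v
    · rw [hiv]
      exact hmem _ (Set.mem_insert _ _)
    · refine hmem _ (Set.mem_insert_of_mem _ ⟨(p i, i), (hp i i.2 hiv).1, ?_⟩)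
      simp [φ, hiv]
  · by_cases he : ((j : V), (i : V)) ∈ G.edges
    · rw [mat, if_pos (Or.inr he)]
      by_cases ht : (i : V) ≠ v ∧ (j : V) = p i
      · have h1 : (s i)⁻¹ * (x (i, j) * s j) = 1 := by
          rw [ht.2, ← hs' i i.2 ht.1, inv_mul_cancel₀ (hs i)]
        rw [mul_assoc, h1]
        exact one_mem _
      · refine hmem _ (Set.mem_insert_of_mem _ ⟨(j, i), he, ?_⟩)
        simp only [φ]
        rw [if_neg ht]
    · rw [mat, if_neg (by simp [hij, he]), mul_zero, zero_mul]
      exact zero_mem _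

/-- The diagonal minor at `v` of `x - A`, and `0` if `v` is not a vertex. -/
noncomputable def minorAt {S : Type*} [CommRing S] (G : CompartmentGraph V) (v : V)
    (A : Matrix G.verts G.verts S) : S[X] :=
  A.adjForm (fun i => if (i : V) = v then 1 else 0) (fun i => if (i : V) = v then 1 else 0)

/-- The diagonal minor at `v` of `x - A` with `r` deleted, and `0` if `v = r`. -/
noncomputable def deletedMinorAt {S : Type*} [CommRing S] (G : CompartmentGraph V) (r v : V)
    (A : Matrix G.verts G.verts S) : S[X] :=
  (G.deleteVertex r A).adjForm (fun i => if ((i : G.verts) : V) = v then 1 else 0)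
    (fun i => if ((i : G.verts) : V) = v then 1 else 0)

theorem StronglyConnected.exists_generators {G : CompartmentGraph V} (hG : G.StronglyConnected)
    {v : V} (hv : v ∈ G.verts) {x : V × V → Ω} (hx : ∀ e, x e ≠ 0) :
    ∃ T : Set Ω, T.encard ≤ G.edges.card ∧ ∀ r n,
      (G.mat x).charpoly.coeff n ∈ algClosureOf k (insert (x (v, v)) T) ∧
      (G.deleteVertex r (G.mat x)).charpoly.coeff n ∈ algClosureOf k (insert (x (v, v)) T) ∧
      (G.minorAt v (G.mat x)).coeff n ∈ algClosureOf k (insert (x (v, v)) T) ∧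
      (G.deletedMinorAt r v (G.mat x)).coeff n ∈ algClosureOf k (insert (x (v, v)) T) := by
  obtain ⟨T, hT, s, hs, h⟩ := hG.exists_conj (k := k) hv hx
  refine ⟨T, hT, fun r n => ?_⟩
  set F := algClosureOf k (insert (x (v, v)) T)
  let B : Matrix G.verts G.verts Ω := fun i j => (s i)⁻¹ * G.mat x i j * s j
  have hB : ∀ i j, B i j ∈ F := h
  have hB' : ∀ i j, G.deleteVertex r B i j ∈ F := fun i j => h i j
  obtain ⟨e1, e2⟩ := Matrix.charmatrix_adjugate_of_conj (A := G.mat x) (B := B) hs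
    (fun i j => rfl)
  obtain ⟨e3, e4⟩ := Matrix.charmatrix_adjugate_of_conj (A := G.deleteVertex r (G.mat x))
    (B := G.deleteVertex r B) (s := fun i => s i) (fun i => hs i) (fun i j => rfl)
  refine ⟨e1 ▸ Matrix.coeff_charpoly_mem F hB n, e3 ▸ Matrix.coeff_charpoly_mem F hB' n, ?_, ?_⟩
  · have : G.minorAt v (G.mat x) = G.minorAt v B := by
      rw [minorAt, minorAt, Matrix.adjForm_indicator _ _ Subtype.val_injective,
        Matrix.adjForm_indicator _ _ Subtype.val_injective]
      simp only [e2]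
    rw [this]
    refine Matrix.coeff_adjForm_mem F hB ?_ ?_ n <;>
    · intro i
      split_ifs
      exacts [one_mem _, zero_mem _]
  · have hinj : Function.Injective (fun i : {i : G.verts // (i : V) ≠ r} => ((i : G.verts) : V)) :=
      Subtype.val_injective.comp Subtype.val_injective
    have : G.deletedMinorAt r v (G.mat x) = G.deletedMinorAt r v B := by
      rw [deletedMinorAt, deletedMinorAt, Matrix.adjForm_indicator _ _ hinj,
        Matrix.adjForm_indicator _ _ hinj]
      simp only [e4]
    rw [this]
    refine Matrix.coeff_adjForm_mem F hB' ?_ ?_ n <;>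
    · intro i
      split_ifs
      exacts [one_mem _, zero_mem _]

end Upper

/-! ### Characteristic polynomials of a graph glued at one vertex -/

section Gluing

variable {S : Type*} [CommRing S] [IsDomain S]

/-- The row of `v` without the diagonal entry. -/
def rowAt (G : CompartmentGraph V) (v : V) (A : Matrix G.verts G.verts S) :
    {i : G.verts // (i : V) ≠ v} → S :=
  fun j => if h : v ∈ G.verts then A ⟨v, h⟩ j else 0

/-- The column of `v` without the diagonal entry. -/
def colAt (G : CompartmentGraph V) (v : V) (A : Matrix G.verts G.verts S) :
    {i : G.verts // (i : V) ≠ v} → S :=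
  fun i => if h : v ∈ G.verts then A i ⟨v, h⟩ else 0

/-- The polynomial `p` such that the characteristic polynomial of `A` is `(X - a) d - p`, where
`a` is the diagonal entry at `v` and `d` the characteristic polynomial of `A` with `v` deleted. -/
noncomputable def feedbackPoly (G : CompartmentGraph V) (v : V) (A : Matrix G.verts G.verts S) :
    S[X] :=
  (G.deleteVertex v A).adjForm (G.rowAt v A) (G.colAt v A)

/-- The two sides meet only at `v`, so the off-diagonal blocks have rank at most one. The index maps
let one computation serve both the whole matrix and the matrix without `r`; the entry at `(v, v)`
belongs to the block of `G₁`. -/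
theorem charpoly_submatrix_union {G₁ G₂ : CompartmentGraph V} {v : V}
    (hv : G₁.verts ∩ G₂.verts = {v}) (x : V × V → S) {ι ι₁ : Type*} [Fintype ι] [DecidableEq ι]
    [Fintype ι₁] [DecidableEq ι₁] (f : ι → (G₁.union G₂).verts) (f₁ : ι₁ → G₁.verts)
    (e : ι₁ ⊕ {i : G₂.verts // (i : V) ≠ v} ≃ ι) (he₁ : ∀ i, (f (e (Sum.inl i)) : V) = f₁ i)
    (he₂ : ∀ i, (f (e (Sum.inr i)) : V) = (i : G₂.verts)) :
    (((G₁.union G₂).mat x).submatrix f f).charpoly =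
      (G₂.deleteVertex v (G₂.mat x)).charpoly * ((G₁.mat x).submatrix f₁ f₁).charpoly -
        G₂.feedbackPoly v (G₂.mat x) * ((G₁.mat x).submatrix f₁ f₁).adjForm
          (fun i => if (f₁ i : V) = v then 1 else 0) (fun i => if (f₁ i : V) = v then 1 else 0) := by
  have hvmem : ∀ i, i ∈ G₁.verts → i ∈ G₂.verts → i = v := by
    intro i h1 h2
    have : i ∈ G₁.verts ∩ G₂.verts := Finset.mem_inter.2 ⟨h1, h2⟩
    rw [hv] at this
    exact Finset.mem_singleton.1 this
  have hv2 : v ∈ G₂.verts := (Finset.mem_inter.1 (hv ▸ Finset.mem_singleton_self v)).2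
  rw [feedbackPoly, ← Matrix.charpoly_fromBlocks_vecMulVec, ← Matrix.charpoly_reindex e.symm]
  congr 1
  have hE : ∀ j i, (j, i) ∈ (G₁.union G₂).edges ↔ (j, i) ∈ G₁.edges ∨ (j, i) ∈ G₂.edges := by
    intro j i; exact Finset.mem_union
  have hfe : ∀ a b : ι, f a = f b ↔ (f a : V) = f b := fun a b => Subtype.ext_iff
  ext i j
  rcases i with i | i <;> rcases j with j | j
  · simp only [Matrix.reindex_apply, Equiv.symm_symm, Matrix.submatrix_apply, mat, hE, hfe, he₁,
      Matrix.fromBlocks_apply₁₁]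
    have : ((f₁ j : V), (f₁ i : V)) ∉ G₂.edges := by
      intro h
      have h1 := hvmem _ (f₁ j).2 (G₂.mem_verts _ h).1
      have h2 := hvmem _ (f₁ i).2 (G₂.mem_verts _ h).2
      exact G₂.loopless _ h (h1.trans h2.symm)
    simp only [this, or_false, Subtype.ext_iff]
  · simp only [Matrix.reindex_apply, Equiv.symm_symm, Matrix.submatrix_apply, mat, hE, hfe, he₁,
      he₂, Matrix.fromBlocks_apply₁₂, Matrix.vecMulVec_apply, rowAt, dif_pos hv2]
    have h1 : (((j : G₂.verts) : V), (f₁ i : V)) ∉ G₁.edges := fun h =>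
      j.2 (hvmem _ (G₁.mem_verts _ h).1 (j : G₂.verts).2)
    by_cases hi : (f₁ i : V) = v
    · have h1' : (((j : G₂.verts) : V), v) ∉ G₁.edges := hi ▸ h1
      simp [hi, h1', Subtype.ext_iff]
    · have h2 : (((j : G₂.verts) : V), (f₁ i : V)) ∉ G₂.edges := fun h =>
        hi (hvmem _ (f₁ i).2 (G₂.mem_verts _ h).2)
      have h3 : (f₁ i : V) ≠ (j : G₂.verts) := fun h =>
        hi (hvmem _ (f₁ i).2 (h ▸ (j : G₂.verts).2))
      simp [hi, h1, h2, h3]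
  · simp only [Matrix.reindex_apply, Equiv.symm_symm, Matrix.submatrix_apply, mat, hE, hfe, he₁,
      he₂, Matrix.fromBlocks_apply₂₁, Matrix.vecMulVec_apply, colAt, dif_pos hv2]
    have h1 : ((f₁ j : V), ((i : G₂.verts) : V)) ∉ G₁.edges := fun h =>
      i.2 (hvmem _ (G₁.mem_verts _ h).2 (i : G₂.verts).2)
    by_cases hj : (f₁ j : V) = v
    · have h1' : (v, ((i : G₂.verts) : V)) ∉ G₁.edges := hj ▸ h1
      simp [hj, h1', Subtype.ext_iff]
    · have h2 : ((f₁ j : V), ((i : G₂.verts) : V)) ∉ G₂.edges := fun h =>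
        hj (hvmem _ (f₁ j).2 (G₂.mem_verts _ h).1)
      have h3 : ((i : G₂.verts) : V) ≠ f₁ j := fun h =>
        hj (hvmem _ (f₁ j).2 (h ▸ (i : G₂.verts).2))
      simp [hj, h1, h2, h3]
  · simp only [Matrix.reindex_apply, Equiv.symm_symm, Matrix.submatrix_apply, mat, hE, hfe, he₂,
      Matrix.fromBlocks_apply₂₂, deleteVertex]
    have : (((j : G₂.verts) : V), ((i : G₂.verts) : V)) ∉ G₁.edges := fun h =>
      i.2 (hvmem _ (G₁.mem_verts _ h).2 (i : G₂.verts).2)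
    simp only [this, false_or, Subtype.ext_iff]

theorem charpoly_union {G₁ G₂ : CompartmentGraph V} {v : V}
    (hv : G₁.verts ∩ G₂.verts = {v}) (x : V × V → S) :
    ((G₁.union G₂).mat x).charpoly =
      (G₂.deleteVertex v (G₂.mat x)).charpoly * (G₁.mat x).charpoly -
        G₂.feedbackPoly v (G₂.mat x) * G₁.minorAt v (G₁.mat x) := by
  have hvmem : ∀ i, i ∈ G₁.verts → i ∈ G₂.verts → i = v := by
    intro i h1 h2
    have : i ∈ G₁.verts ∩ G₂.verts := Finset.mem_inter.2 ⟨h1, h2⟩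
    rw [hv] at this
    exact Finset.mem_singleton.1 this
  have hv1 : v ∈ G₁.verts := (Finset.mem_inter.1 (hv ▸ Finset.mem_singleton_self v)).1
  let g : G₁.verts ⊕ {i : G₂.verts // (i : V) ≠ v} → (G₁.union G₂).verts :=
    Sum.elim (fun i => ⟨i, Finset.mem_union_left _ i.2⟩)
      (fun i => ⟨(i : G₂.verts), Finset.mem_union_right _ (i : G₂.verts).2⟩)
  have hg : Function.Bijective g := by
    constructor
    · rintro (a | a) (b | b) h <;> have h' := congrArg Subtype.val h <;>
        simp only [g, Sum.elim_inl, Sum.elim_inr] at h'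
      · exact congrArg _ (Subtype.ext h')
      · exact absurd (hvmem _ (h' ▸ a.2) (b : G₂.verts).2) b.2
      · exact absurd (hvmem _ (h' ▸ b.2) (a : G₂.verts).2) a.2
      · exact congrArg _ (Subtype.ext (Subtype.ext h'))
    · rintro ⟨i, hi⟩
      by_cases h1 : i ∈ G₁.verts
      · exact ⟨Sum.inl ⟨i, h1⟩, rfl⟩
      · have h2 := (Finset.mem_union.1 hi).resolve_left h1
        exact ⟨Sum.inr ⟨⟨i, h2⟩, fun h => h1 (by have h3 : i = v := h; exact h3 ▸ hv1)⟩, rfl⟩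
  have := charpoly_submatrix_union hv x id id
    (Equiv.ofBijective g hg) (fun i => rfl) (fun i => rfl)
  exact this

theorem charpoly_deleteVertex_union {G₁ G₂ : CompartmentGraph V} {r v : V}
    (hv : G₁.verts ∩ G₂.verts = {v}) (hr : r ∈ G₁.verts) (x : V × V → S) :
    ((G₁.union G₂).deleteVertex r ((G₁.union G₂).mat x)).charpoly =
      (G₂.deleteVertex v (G₂.mat x)).charpoly * (G₁.deleteVertex r (G₁.mat x)).charpoly -
        G₂.feedbackPoly v (G₂.mat x) * G₁.deletedMinorAt r v (G₁.mat x) := by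
  have hvmem : ∀ i, i ∈ G₁.verts → i ∈ G₂.verts → i = v := by
    intro i h1 h2
    have : i ∈ G₁.verts ∩ G₂.verts := Finset.mem_inter.2 ⟨h1, h2⟩
    rw [hv] at this
    exact Finset.mem_singleton.1 this
  have hv1 : v ∈ G₁.verts := (Finset.mem_inter.1 (hv ▸ Finset.mem_singleton_self v)).1
  let g : {i : G₁.verts // (i : V) ≠ r} ⊕ {i : G₂.verts // (i : V) ≠ v} →
      {i : (G₁.union G₂).verts // (i : V) ≠ r} :=
    Sum.elim (fun i => ⟨⟨(i : G₁.verts), Finset.mem_union_left _ (i : G₁.verts).2⟩, i.2⟩)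
      (fun i => ⟨⟨(i : G₂.verts), Finset.mem_union_right _ (i : G₂.verts).2⟩,
        fun h => i.2 (hvmem _ (by have h3 : ((i : G₂.verts) : V) = r := h; exact h3 ▸ hr) (i : G₂.verts).2)⟩)
  have hg : Function.Bijective g := by
    constructor
    · rintro (a | a) (b | b) h <;>
        have h' := congrArg (fun i : {i : (G₁.union G₂).verts // (i : V) ≠ r} =>
          ((i : (G₁.union G₂).verts) : V)) h <;>
        simp only [g, Sum.elim_inl, Sum.elim_inr] at h'
      · exact congrArg _ (Subtype.ext (Subtype.ext h'))
      · exact absurd (hvmem _ (h' ▸ (a : G₁.verts).2) (b : G₂.verts).2) b.2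
      · exact absurd (hvmem _ (h' ▸ (b : G₁.verts).2) (a : G₂.verts).2) a.2
      · exact congrArg _ (Subtype.ext (Subtype.ext h'))
    · rintro ⟨⟨i, hi⟩, hir⟩
      by_cases h1 : i ∈ G₁.verts
      · exact ⟨Sum.inl ⟨⟨i, h1⟩, hir⟩, rfl⟩
      · have h2 := (Finset.mem_union.1 hi).resolve_left h1
        exact ⟨Sum.inr ⟨⟨i, h2⟩, fun h => h1 (by have h3 : i = v := h; exact h3 ▸ hv1)⟩, rfl⟩
  exact charpoly_submatrix_union hv x Subtype.val Subtype.val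
    (Equiv.ofBijective g hg) (fun i => rfl) (fun i => rfl)

theorem charpoly_eq_sub_feedbackPoly (G : CompartmentGraph V) {v : V} (hv : v ∈ G.verts)
    (x : V × V → S) :
    (G.mat x).charpoly = (X - C (x (v, v))) * (G.deleteVertex v (G.mat x)).charpoly -
      G.feedbackPoly v (G.mat x) := by
  -- Expansion at `v` is the gluing formula for `G` attached to a single vertex.
  let G₁ : CompartmentGraph V := ⟨{v}, ∅, by simp, by simp⟩
  have hun : G₁.union G = G := by
    obtain ⟨W, E, hE, hl⟩ := G
    simp only [union, G₁, mk.injEq, Finset.empty_union, and_true]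
    exact Finset.union_eq_right.2 (Finset.singleton_subset_iff.2 hv)
  have := charpoly_union (G₁ := G₁) (G₂ := G) (v := v) (by simp [G₁, hv]) x
  rw [hun] at this
  rw [this]
  have hu : Unique G₁.verts :=
    ⟨⟨⟨v, Finset.mem_singleton_self v⟩⟩, fun y => Subtype.ext (Finset.mem_singleton.1 y.2)⟩
  have hd : ((default : G₁.verts) : V) = v := Finset.mem_singleton.1 (default : G₁.verts).2
  have h1 : (G₁.mat x).charpoly = X - C (x (v, v)) := by
    rw [Matrix.charpoly, Matrix.det_unique, Matrix.charmatrix_apply_eq, mat, if_pos (Or.inl rfl),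
      hd]
  have h2 : G₁.minorAt v (G₁.mat x) = 1 := by
    rw [minorAt, Matrix.adjForm_indicator _ _ Subtype.val_injective, Finset.univ_unique,
      Finset.sum_singleton, if_pos hd, Matrix.adjugate_subsingleton, Matrix.one_apply_eq]
  rw [h1, h2]; ring

end Gluing

end CompartmentGraph

/-! ### Degrees, and the rank bound for the glued graph -/

section Degree

variable {m R : Type*} [Fintype m] [DecidableEq m] [CommRing R] [IsDomain R]

/-- If an entry of maximal degree M had M at least the size of the matrix, the coefficient of degree
M + 1 in `(x - A) adj(x - A) = det` would be nonzero on the left and zero on the right. -/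
theorem Matrix.natDegree_adjugate_charmatrix_lt (A : Matrix m m R) (i j : m) :
    (A.charmatrix.adjugate i j).natDegree < Fintype.card m := by
  obtain ⟨⟨a, b⟩, -, hab⟩ := Finset.exists_max_image (Finset.univ : Finset (m × m))
    (fun e => (A.charmatrix.adjugate e.1 e.2).natDegree) ⟨(i, j), Finset.mem_univ _⟩
  refine lt_of_le_of_lt (hab (i, j) (Finset.mem_univ _)) ?_
  by_contra hlt
  push Not at hlt
  set Q := A.charmatrix.adjugate with hQ
  set M := (Q a b).natDegree with hM
  have h0 : 0 < Fintype.card m := Fintype.card_pos_iff.2 ⟨a⟩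
  have hne : Q a b ≠ 0 := by
    intro h
    have : M = 0 := by rw [hM, h, natDegree_zero]
    exact absurd (this ▸ hlt) (not_le.2 h0)
  have key := congrFun (congrFun (Matrix.mul_adjugate A.charmatrix) a) b
  rw [Matrix.mul_apply] at key
  simp only [Matrix.charmatrix_apply, sub_mul, Finset.sum_sub_distrib, Matrix.diagonal_apply,
    ite_mul, zero_mul, Finset.sum_ite_eq, Finset.mem_univ, if_true] at key
  have hc := congrArg (fun P => P.coeff (M + 1)) key
  simp only [coeff_sub, coeff_X_mul, finsetSum_coeff, coeff_C_mul, Matrix.smul_apply,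
    smul_eq_mul] at hc
  rw [Finset.sum_eq_zero, sub_zero] at hc
  · have h1 : (A.charmatrix.det * (1 : Matrix m m R[X]) a b).coeff (M + 1) = 0 := by
      rw [Matrix.one_apply]
      split_ifs
      · rw [mul_one]
        refine coeff_eq_zero_of_natDegree_lt ?_
        change A.charpoly.natDegree < _
        rw [A.charpoly_natDegree_eq_dim]
        omega
      · simp
    rw [h1] at hc
    exact hne (leadingCoeff_eq_zero.1 hc)
  · intro l _
    rw [coeff_eq_zero_of_natDegree_lt (lt_of_le_of_lt (hab (l, b) (Finset.mem_univ _))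
      (Nat.lt_succ_self _)), mul_zero]

theorem Matrix.degree_adjForm_lt (A : Matrix m m R) (b c : m → R) :
    (A.adjForm b c).degree < A.charpoly.degree := by
  rw [A.charpoly_degree_eq_dim, degree_lt_iff_coeff_zero]
  intro n hn
  simp only [Matrix.adjForm, dotProduct, Matrix.mulVec, finsetSum_coeff, coeff_C_mul, coeff_mul_C]
  refine Finset.sum_eq_zero fun i _ => ?_
  rw [Finset.sum_eq_zero, mul_zero]
  intro j _
  rw [coeff_eq_zero_of_natDegree_lt, zero_mul]
  exact lt_of_lt_of_le (A.natDegree_adjugate_charmatrix_lt i j) (by exact_mod_cast hn)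

end Degree

theorem Polynomial.forall_coeff_mul_mem {Ω σ : Type*} [CommRing Ω] [SetLike σ Ω]
    [SubringClass σ Ω] (F : σ) {P Q : Polynomial Ω} (hP : ∀ n, P.coeff n ∈ F)
    (hQ : ∀ n, Q.coeff n ∈ F) (n : ℕ) : (P * Q).coeff n ∈ F := by
  rw [coeff_mul]
  exact sum_mem fun e _ => mul_mem (hP _) (hQ _)

theorem Polynomial.forall_coeff_sub_mem {Ω σ : Type*} [CommRing Ω] [SetLike σ Ω]
    [SubringClass σ Ω] (F : σ) {P Q : Polynomial Ω} (hP : ∀ n, P.coeff n ∈ F)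
    (hQ : ∀ n, Q.coeff n ∈ F) (n : ℕ) : (P - Q).coeff n ∈ F := by
  rw [coeff_sub]
  exact sub_mem (hP _) (hQ _)

theorem Polynomial.forall_coeff_X_sub_C_mem {Ω σ : Type*} [CommRing Ω] [SetLike σ Ω]
    [SubringClass σ Ω] (F : σ) {a : Ω} (ha : a ∈ F) (n : ℕ) : (X - C a).coeff n ∈ F := by
  rw [coeff_sub, coeff_X, coeff_C]
  split_ifs <;> first | exact sub_mem (one_mem _) ha | skip
  · exact sub_mem (one_mem _) (zero_mem _)
  · exact sub_mem (zero_mem _) ha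
  · exact sub_mem (zero_mem _) (zero_mem _)

namespace CompartmentGraph

variable {V : Type*} [DecidableEq V] {k Ω : Type*} [Field k] [Field Ω] [Algebra k Ω]

theorem degree_feedbackPoly_lt {S : Type*} [CommRing S] [IsDomain S] (G : CompartmentGraph V)
    (v : V) (A : Matrix G.verts G.verts S) :
    (G.feedbackPoly v A).degree < (G.deleteVertex v A).charpoly.degree :=
  Matrix.degree_adjForm_lt _ _ _

theorem diagonal_mem_and_coeff_feedbackPoly_mem (G : CompartmentGraph V) {v : V} (hv : v ∈ G.verts)
    (x : V × V → Ω) (F : IntermediateField k Ω) (hF : ∀ y ∈ G.coeffSet v (G.mat x), y ∈ F) :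
    x (v, v) ∈ F ∧ ∀ n, (G.feedbackPoly v (G.mat x)).coeff n ∈ F := by
  have h := G.charpoly_eq_sub_feedbackPoly hv x
  set d := (G.deleteVertex v (G.mat x)).charpoly with hd
  have hdF : ∀ n, d.coeff n ∈ F := fun n => hF _ (Or.inr ⟨n, rfl⟩)
  have hfF : ∀ n, (G.mat x).charpoly.coeff n ∈ F := fun n => hF _ (Or.inl ⟨n, rfl⟩)
  have hdm : d.Monic := Matrix.charpoly_monic _
  have ha : x (v, v) ∈ F := by
    -- The feedback has degree below that of `d`, so this coefficient isolates the diagonal entry at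
    -- `v`.
    have h1 := congrArg (fun P => P.coeff d.natDegree) h
    have h2 : (G.feedbackPoly v (G.mat x)).coeff d.natDegree = 0 :=
      coeff_eq_zero_of_degree_lt
        ((G.degree_feedbackPoly_lt v (G.mat x)).trans_eq (degree_eq_natDegree hdm.ne_zero))
    have h3 : (X * d).coeff d.natDegree ∈ F := by
      refine Polynomial.forall_coeff_mul_mem F (fun n => ?_) hdF _
      rw [coeff_X]; split_ifs; exacts [one_mem _, zero_mem _]
    simp only [coeff_sub, h2, sub_mul, coeff_C_mul, hdm.coeff_natDegree, mul_one, sub_zero] at h1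
    have h4 : x (v, v) = (X * d).coeff d.natDegree - (G.mat x).charpoly.coeff d.natDegree := by
      rw [h1]; ring
    rw [h4]
    exact sub_mem h3 (hfF _)
  refine ⟨ha, ?_⟩
  have hp : G.feedbackPoly v (G.mat x) = (X - C (x (v, v))) * d - (G.mat x).charpoly := by
    rw [h]; ring
  rw [hp]
  exact Polynomial.forall_coeff_sub_mem F (Polynomial.forall_coeff_mul_mem F
    (Polynomial.forall_coeff_X_sub_C_mem F ha) hdF) hfF

theorem StronglyConnected.eRk_coeffSet_le_card {G : CompartmentGraph V}
    (hG : G.StronglyConnected) {v : V} (hv : v ∈ G.verts) {x : V × V → Ω} (hx : ∀ e, x e ≠ 0) :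
    (AlgebraicIndependent.matroid k Ω).eRk (G.coeffSet v (G.mat x)) ≤
      ((G.edges.card + 1 : ℕ) : ℕ∞) := by
  obtain ⟨T, hT, h⟩ := hG.exists_generators (k := k) hv hx
  have hsub : G.coeffSet v (G.mat x) ⊆
      (AlgebraicIndependent.matroid k Ω).closure (insert (x (v, v)) T) := by
    rintro _ (⟨n, rfl⟩ | ⟨n, rfl⟩)
    · exact mem_algClosureOf.1 (h v n).1
    · exact mem_algClosureOf.1 (h v n).2.1
  refine (Matroid.eRk_mono _ hsub).trans ?_
  rw [Matroid.eRk_closure_eq]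
  refine (Matroid.eRk_le_encard _ _).trans ((Set.encard_insert_le _ _).trans ?_)
  push_cast
  gcongr

theorem eRk_coeffSet_union_le {G₁ G₂ : CompartmentGraph V} {r v : V}
    (h₁ : G₁.StronglyConnected) (hv : G₁.verts ∩ G₂.verts = {v}) (hr : r ∈ G₁.verts)
    {x : V × V → Ω} (hx : ∀ e, x e ≠ 0) :
    (AlgebraicIndependent.matroid k Ω).eRk ((G₁.union G₂).coeffSet r ((G₁.union G₂).mat x)) ≤
      G₁.edges.card + (AlgebraicIndependent.matroid k Ω).eRk (G₂.coeffSet v (G₂.mat x)) := by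
  have hv12 := Finset.mem_inter.1 (hv ▸ Finset.mem_singleton_self v)
  obtain ⟨T, hT, h⟩ := h₁.exists_generators (k := k) hv12.1 hx
  set Γ := G₂.coeffSet v (G₂.mat x) with hΓ
  set F := algClosureOf k (T ∪ Γ) with hF
  have hmem : ∀ y ∈ T ∪ Γ, y ∈ F := fun y hy =>
    mem_algClosureOf.2 (Matroid.mem_closure_of_mem _ hy)
  obtain ⟨ha, hp⟩ := G₂.diagonal_mem_and_coeff_feedbackPoly_mem hv12.2 x F
    (fun y hy => hmem y (Or.inr hy))
  have hle : ∀ y ∈ algClosureOf k (insert (x (v, v)) T), y ∈ F := by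
    intro y hy
    rw [mem_algClosureOf] at hy ⊢
    refine Matroid.closure_subset_closure_of_subset_closure ?_ hy
    rintro z (rfl | hz)
    · exact mem_algClosureOf.1 ha
    · exact mem_algClosureOf.1 (hmem _ (Or.inl hz))
  have hd : ∀ n, (G₂.deleteVertex v (G₂.mat x)).charpoly.coeff n ∈ F := fun n =>
    hmem _ (Or.inr (Or.inr ⟨n, rfl⟩))
  have hsub : (G₁.union G₂).coeffSet r ((G₁.union G₂).mat x) ⊆
      (AlgebraicIndependent.matroid k Ω).closure (T ∪ Γ) := by
    rintro _ (⟨n, rfl⟩ | ⟨n, rfl⟩) <;> rw [← mem_algClosureOf]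
    · rw [charpoly_union hv]
      exact Polynomial.forall_coeff_sub_mem F
        (Polynomial.forall_coeff_mul_mem F hd fun n => hle _ (h r n).1)
        (Polynomial.forall_coeff_mul_mem F hp fun n => hle _ (h r n).2.2.1) n
    · rw [charpoly_deleteVertex_union hv hr]
      exact Polynomial.forall_coeff_sub_mem F
        (Polynomial.forall_coeff_mul_mem F hd fun n => hle _ (h r n).2.1)
        (Polynomial.forall_coeff_mul_mem F hp fun n => hle _ (h r n).2.2.2) n
  refine (Matroid.eRk_mono _ hsub).trans ?_
  rw [Matroid.eRk_closure_eq]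
  refine (Matroid.eRk_union_le_encard_add_eRk _ _ _).trans ?_
  gcongr

end CompartmentGraph

/-- A derivation, applied to the coefficients of a polynomial. -/
noncomputable def Derivation.onCoeffs {k Ω : Type*} [Field k] [Field Ω] [Algebra k Ω]
    (δ : Derivation k Ω Ω) : Derivation ℤ (Polynomial Ω) (Polynomial Ω) :=
  letI : Differential Ω := ⟨δ.restrictScalars ℤ⟩
  Differential.mapCoeffs

theorem Derivation.coeff_onCoeffs {k Ω : Type*} [Field k] [Field Ω] [Algebra k Ω]
    (δ : Derivation k Ω Ω) (P : Polynomial Ω) (n : ℕ) :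
    (δ.onCoeffs P).coeff n = δ (P.coeff n) := by
  let : Differential Ω := ⟨δ.restrictScalars ℤ⟩
  exact Differential.coeff_mapCoeffs P n

/-- Eliminating as in Cramer's rule, `d` divides `u` and `π` times a polynomial coprime to `d`; the
degree bounds do the rest. -/
theorem Polynomial.eq_zero_of_isCoprime_of_linear_relations {K : Type*} [Field K]
    {f fr g h d u w wr π : K[X]} (hu : u.degree < d.degree) (hπ : π.degree < d.degree)
    (hcop : IsCoprime (f * h - g * fr) d) (h1 : u * f + d * w - π * g = 0)
    (h2 : u * fr + d * wr - π * h = 0) : u = 0 ∧ π = 0 ∧ w = 0 ∧ wr = 0 := by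
  have hd : d ≠ 0 := by rintro rfl; simp at hu
  have hu0 : u = 0 := by
    refine eq_zero_of_dvd_of_degree_lt (hcop.symm.dvd_of_dvd_mul_right ?_) hu
    exact ⟨wr * g - w * h, by linear_combination h * h1 - g * h2⟩
  have hπ0 : π = 0 := by
    refine eq_zero_of_dvd_of_degree_lt (hcop.symm.dvd_of_dvd_mul_right ?_) hπ
    exact ⟨wr * f - w * fr, by linear_combination fr * h1 - f * h2⟩
  refine ⟨hu0, hπ0, ?_, ?_⟩
  · rw [hu0, hπ0] at h1
    simpa [hd] using h1
  · rw [hu0, hπ0] at h2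
    simpa [hd] using h2

/-! ### Deformation by ε: recovering the factors by derivations -/

section Deformation

variable {k K Ω : Type*} [Field k] [CharZero k] [Field K] [Field Ω] [Algebra k K] [Algebra k Ω]
  [Algebra K Ω] [IsScalarTower k K Ω] [Algebra K[X] Ω] [IsScalarTower K K[X] Ω]
  [IsFractionRing K[X] Ω]

/-- The polynomial `d f - ε p g` over `K(ε)`. -/
noncomputable def deformedPoly (Ω : Type*) {K : Type*} [Field K] [Field Ω] [Algebra K Ω]
    [Algebra K[X] Ω] (d f p g : K[X]) : Polynomial Ω :=
  (d * f).map (algebraMap K Ω) - C (algebraMap K[X] Ω X) * (p * g).map (algebraMap K Ω)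

/-- The values of a derivation on the coefficients of `f`, `fr`, `d` and `ε p`. -/
def derivationValues (f fr d p : K[X]) (δ : Derivation k Ω Ω) : Set Ω :=
  (Set.range fun n => δ (algebraMap K Ω (f.coeff n))) ∪
  (Set.range fun n => δ (algebraMap K Ω (fr.coeff n))) ∪
  (Set.range fun n => δ (algebraMap K Ω (d.coeff n))) ∪
  (Set.range fun n => algebraMap K[X] Ω X * δ (algebraMap K Ω (p.coeff n)))

omit [CharZero k] [IsScalarTower k K Ω] [IsScalarTower K K[X] Ω] [IsFractionRing K[X] Ω]
  [Algebra k K] in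
theorem derivationValues_smul (f fr d p : K[X]) (δ : Derivation k Ω Ω) (c : Ω) :
    derivationValues f fr d p (c • δ) = (fun y => c * y) '' derivationValues f fr d p δ := by
  simp only [derivationValues, Set.image_union, ← Set.range_comp]
  congr! 3
  simp only [Function.comp, Derivation.smul_apply, smul_eq_mul]
  ring

variable {f fr g h d p : K[X]}

/-- The descent step: if the values are polynomials in ε, differentiating the two deformed
polynomials and setting ε = 0 shows that they are multiples of ε. -/
theorem derivationValues_divisible (hd : d.Monic) (hp : p.degree < d.degree)
    (hcop : IsCoprime (f * h - g * fr) d)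
    (hg : ∀ n, IsAlgebraic (IntermediateField.adjoin k
      (Set.range f.coeff ∪ Set.range fr.coeff)) (g.coeff n))
    (hh : ∀ n, IsAlgebraic (IntermediateField.adjoin k
      (Set.range f.coeff ∪ Set.range fr.coeff)) (h.coeff n))
    {δ : Derivation k Ω Ω} (hε : δ (algebraMap K[X] Ω X) = 0)
    (hF : ∀ n, δ ((deformedPoly Ω d f p g).coeff n) = 0)
    (hFr : ∀ n, δ ((deformedPoly Ω d fr p h).coeff n) = 0)
    (hint : ∀ y ∈ derivationValues f fr d p δ, y ∈ Set.range (algebraMap K[X] Ω)) :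
    ∀ y ∈ derivationValues f fr d p δ, ∃ q : K[X], y = algebraMap K[X] Ω (X * q) := by
  set j := algebraMap K[X] Ω with hj
  have hjinj : Function.Injective j := IsFractionRing.injective K[X] Ω
  have hjC : ∀ P : K[X], (P.map (C : K →+* K[X])).map j = P.map (algebraMap K Ω) := by
    intro P
    rw [Polynomial.map_map]
    congr 1
    exact (IsScalarTower.algebraMap_eq K K[X] Ω).symm
  have h1 : ∀ n, δ (algebraMap K Ω (f.coeff n)) ∈ Set.range j := fun n =>
    hint _ (Or.inl (Or.inl (Or.inl ⟨n, rfl⟩)))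
  have h2 : ∀ n, δ (algebraMap K Ω (fr.coeff n)) ∈ Set.range j := fun n =>
    hint _ (Or.inl (Or.inl (Or.inr ⟨n, rfl⟩)))
  have h3 : ∀ n, δ (algebraMap K Ω (d.coeff n)) ∈ Set.range j := fun n =>
    hint _ (Or.inl (Or.inr ⟨n, rfl⟩))
  have h4 : ∀ n, j X * δ (algebraMap K Ω (p.coeff n)) ∈ Set.range j := fun n =>
    hint _ (Or.inr ⟨n, rfl⟩)
  let O : Submodule K Ω := LinearMap.range (IsScalarTower.toAlgHom K K[X] Ω).toLinearMap
  have hO : ∀ y, y ∈ O ↔ y ∈ Set.range j := fun y => Iff.rfl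
  -- Having values in K[ε] means vanishing of this derivation, so integrality passes from `f`, `fr`
  -- to the algebraic elements `g`, `h`.
  let D0 : Derivation k K (Ω ⧸ O) := O.mkQ.compDer (δ.compAlgebraMap K)
  have hD0 : ∀ y, D0 y = 0 ↔ δ (algebraMap K Ω y) ∈ Set.range j := fun y => by
    rw [← hO, ← Submodule.Quotient.mk_eq_zero]; rfl
  have hgen : ∀ s ∈ Set.range f.coeff ∪ Set.range fr.coeff, D0 s = 0 := by
    rintro _ (⟨n, rfl⟩ | ⟨n, rfl⟩)
    · exact (hD0 _).2 (h1 n)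
    · exact (hD0 _).2 (h2 n)
  have h5 : ∀ n, δ (algebraMap K Ω (g.coeff n)) ∈ Set.range j := fun n =>
    (hD0 _).1 (D0.eq_zero_of_isAlgebraic hgen (hg n))
  have h6 : ∀ n, δ (algebraMap K Ω (h.coeff n)) ∈ Set.range j := fun n =>
    (hD0 _).1 (D0.eq_zero_of_isAlgebraic hgen (hh n))
  have hlift : ∀ P : K[X], (∀ n, δ (algebraMap K Ω (P.coeff n)) ∈ Set.range j) →
      ∃ Q : K[X][X], Q.map j = δ.onCoeffs (P.map (algebraMap K Ω)) := by
    intro P hP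
    refine (mem_lifts _).1 ((lifts_iff_coeff_lifts _).2 fun n => ?_)
    rw [δ.coeff_onCoeffs, coeff_map]
    exact hP n
  obtain ⟨w, hw⟩ := hlift f h1
  obtain ⟨wr, hwr⟩ := hlift fr h2
  obtain ⟨u, hu⟩ := hlift d h3
  obtain ⟨γ, hγ⟩ := hlift g h5
  obtain ⟨η, hη⟩ := hlift h h6
  obtain ⟨π, hπ⟩ : ∃ Q : K[X][X], Q.map j = C (j X) * δ.onCoeffs (p.map (algebraMap K Ω)) := by
    refine (mem_lifts _).1 ((lifts_iff_coeff_lifts _).2 fun n => ?_)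
    rw [coeff_C_mul, δ.coeff_onCoeffs, coeff_map]
    exact h4 n
  have hεC : δ.onCoeffs (C (j X)) = 0 := by
    ext n
    rw [δ.coeff_onCoeffs, coeff_C]
    split_ifs
    · exact hε
    · exact map_zero δ
  have key : ∀ (f' g' : K[X]) (w' γ' : K[X][X]),
      w'.map j = δ.onCoeffs (f'.map (algebraMap K Ω)) →
      γ'.map j = δ.onCoeffs (g'.map (algebraMap K Ω)) →
      (∀ n, δ ((deformedPoly Ω d f' p g').coeff n) = 0) →
      u.map (evalRingHom 0) * f' + d * w'.map (evalRingHom 0) - π.map (evalRingHom 0) * g' = 0 := by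
    intro f' g' w' γ' hw' hγ' hF'
    have e0 : δ.onCoeffs (deformedPoly Ω d f' p g') = 0 := by
      ext n
      rw [δ.coeff_onCoeffs, hF', coeff_zero]
    have e1 : u * f'.map C + d.map C * w' - π * g'.map C - C X * p.map C * γ' = 0 := by
      apply Polynomial.map_injective j hjinj
      simp only [Polynomial.map_sub, Polynomial.map_add, Polynomial.map_mul, hjC, Polynomial.map_C,
        Polynomial.map_zero, hu, hw', hγ', hπ]
      rw [deformedPoly, map_sub, Derivation.leibniz, hεC, Polynomial.map_mul, Polynomial.map_mul,
        Derivation.leibniz, Derivation.leibniz] at e0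
      simp only [smul_eq_mul, mul_zero, add_zero] at e0
      linear_combination e0
    have hev : ∀ P : K[X], (P.map (C : K →+* K[X])).map (evalRingHom 0) = P := by
      intro P
      have h0 : (evalRingHom (0 : K)).comp C = RingHom.id K := by ext; simp
      rw [Polynomial.map_map, h0, Polynomial.map_id]
    have e2 := congrArg (Polynomial.map (evalRingHom (0 : K))) e1
    simpa [Polynomial.map_sub, Polynomial.map_add, Polynomial.map_mul, hev] using e2
  -- The leading coefficient of the monic `d` is killed by `δ`.
  have hdegu : (u.map (evalRingHom 0)).degree < d.degree := by
    refine lt_of_le_of_lt degree_map_le ?_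
    rw [← degree_map_eq_of_injective hjinj, hu, degree_eq_natDegree hd.ne_zero,
      degree_lt_iff_coeff_zero]
    intro n hn
    rw [δ.coeff_onCoeffs, coeff_map]
    rcases (show d.natDegree ≤ n from hn).eq_or_lt with rfl | hn
    · rw [hd.coeff_natDegree, map_one, δ.map_one_eq_zero]
    · rw [coeff_eq_zero_of_natDegree_lt hn, map_zero, map_zero]
  have hdegπ : (π.map (evalRingHom 0)).degree < d.degree := by
    refine lt_of_le_of_lt degree_map_le ?_
    rw [← degree_map_eq_of_injective hjinj, hπ, degree_eq_natDegree hd.ne_zero,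
      degree_lt_iff_coeff_zero]
    intro n hn
    rw [degree_eq_natDegree hd.ne_zero, degree_lt_iff_coeff_zero] at hp
    rw [coeff_C_mul, δ.coeff_onCoeffs, coeff_map, hp n hn, map_zero, map_zero, mul_zero]
  obtain ⟨z1, z2, z3, z4⟩ := Polynomial.eq_zero_of_isCoprime_of_linear_relations hdegu hdegπ hcop
    (key f g w γ hw hγ hF) (key fr h wr η hwr hη hFr)
  have hdvd : ∀ Q : K[X][X], Q.map (evalRingHom 0) = 0 → ∀ n, ∃ q, (Q.map j).coeff n = j (X * q) := by
    intro Q hQ n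
    have : (Q.coeff n).coeff 0 = 0 := by
      have := congrArg (fun P => P.coeff n) hQ
      simpa [coeff_map, coeff_zero_eq_eval_zero] using this
    obtain ⟨q, hq⟩ := X_dvd_iff.2 this
    exact ⟨q, by rw [coeff_map, hq]⟩
  rintro _ (((⟨n, rfl⟩ | ⟨n, rfl⟩) | ⟨n, rfl⟩) | ⟨n, rfl⟩)
  · have := hdvd w z3 n
    rwa [hw, δ.coeff_onCoeffs, coeff_map] at this
  · have := hdvd wr z4 n
    rwa [hwr, δ.coeff_onCoeffs, coeff_map] at this
  · have := hdvd u z1 n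
    rwa [hu, δ.coeff_onCoeffs, coeff_map] at this
  · have := hdvd π z2 n
    rwa [hπ, coeff_C_mul, δ.coeff_onCoeffs, coeff_map] at this

theorem derivationValues_eq_zero (hd : d.Monic) (hp : p.degree < d.degree)
    (hcop : IsCoprime (f * h - g * fr) d)
    (hg : ∀ n, IsAlgebraic (IntermediateField.adjoin k
      (Set.range f.coeff ∪ Set.range fr.coeff)) (g.coeff n))
    (hh : ∀ n, IsAlgebraic (IntermediateField.adjoin k
      (Set.range f.coeff ∪ Set.range fr.coeff)) (h.coeff n))
    {δ : Derivation k Ω Ω} (hε : δ (algebraMap K[X] Ω X) = 0)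
    (hF : ∀ n, δ ((deformedPoly Ω d f p g).coeff n) = 0)
    (hFr : ∀ n, δ ((deformedPoly Ω d fr p h).coeff n) = 0) :
    ∀ y ∈ derivationValues f fr d p δ, y = 0 := by
  set j := algebraMap K[X] Ω with hj
  have hjinj : Function.Injective j := IsFractionRing.injective K[X] Ω
  have hX : j X ≠ 0 := (map_ne_zero_iff j hjinj).2 X_ne_zero
  -- Induction over all such derivations at once, since the step replaces δ by δ/ε.
  have hpow : ∀ (N : ℕ) (δ : Derivation k Ω Ω), δ (j X) = 0 →
      (∀ n, δ ((deformedPoly Ω d f p g).coeff n) = 0) →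
      (∀ n, δ ((deformedPoly Ω d fr p h).coeff n) = 0) →
      (∀ y ∈ derivationValues f fr d p δ, y ∈ Set.range j) →
      ∀ y ∈ derivationValues f fr d p δ, ∃ q : K[X], y = j (X ^ N * q) := by
    intro N
    induction N with
    | zero =>
      intro δ _ _ _ hint y hy
      obtain ⟨q, hq⟩ := hint y hy
      exact ⟨q, by rw [pow_zero, one_mul, hq]⟩
    | succ N ih =>
      intro δ hε hF hFr hint y hy
      have hdiv := derivationValues_divisible hd hp hcop hg hh hε hF hFr hint
      obtain ⟨q, hq⟩ := ih ((j X)⁻¹ • δ) (by simp [hε]) (by simp [hF]) (by simp [hFr]) (by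
        rw [derivationValues_smul]
        rintro _ ⟨y, hy, rfl⟩
        obtain ⟨q, rfl⟩ := hdiv y hy
        refine ⟨q, ?_⟩
        simp only [← hj, map_mul]
        rw [← mul_assoc, inv_mul_cancel₀ hX, one_mul]) ((j X)⁻¹ * y) (by
        rw [derivationValues_smul]; exact ⟨y, hy, rfl⟩)
      refine ⟨q, ?_⟩
      rw [inv_mul_eq_iff_eq_mul₀ hX] at hq
      rw [hq, ← map_mul]
      congr 1
      ring
  have hzero : ∀ δ : Derivation k Ω Ω, δ (j X) = 0 →
      (∀ n, δ ((deformedPoly Ω d f p g).coeff n) = 0) →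
      (∀ n, δ ((deformedPoly Ω d fr p h).coeff n) = 0) →
      (∀ y ∈ derivationValues f fr d p δ, y ∈ Set.range j) →
      ∀ y ∈ derivationValues f fr d p δ, y = 0 := by
    intro δ hε hF hFr hint y hy
    obtain ⟨q, rfl⟩ := hint y hy
    have : q = 0 := by
      ext n
      obtain ⟨q', hq'⟩ := hpow (n + 1) δ hε hF hFr hint _ hy
      have := hjinj hq'
      exact X_pow_dvd_iff.1 ⟨q', this⟩ n (Nat.lt_succ_self n)
    rw [this, map_zero]
  have hfin : (derivationValues f fr d p δ).Finite := by
    have hc : ∀ (P : K[X]) (φ : K → Ω), (Set.range fun n => φ (P.coeff n)).Finite := by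
      intro P φ
      have : (Set.range P.coeff).Finite := by
        refine (P.coeffs.finite_toSet.union (Set.finite_singleton 0)).subset ?_
        rintro _ ⟨n, rfl⟩
        by_cases hn : P.coeff n = 0
        · exact Or.inr hn
        · exact Or.inl (coeff_mem_coeffs hn)
      rw [show (fun n => φ (P.coeff n)) = φ ∘ P.coeff from rfl, Set.range_comp]
      exact this.image φ
    exact (((hc f fun c => δ (algebraMap K Ω c)).union (hc fr fun c => δ (algebraMap K Ω c))).union
      (hc d fun c => δ (algebraMap K Ω c))).union
      (hc p fun c => algebraMap K[X] Ω X * δ (algebraMap K Ω c))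
  -- The values are finitely many; scaling δ by a common denominator reduces to polynomial values.
  obtain ⟨b, hb⟩ := IsLocalization.exist_integer_multiples_of_finset (nonZeroDivisors K[X])
    hfin.toFinset
  have hb0 : j b ≠ 0 := (map_ne_zero_iff j hjinj).2 (nonZeroDivisors.ne_zero b.2)
  intro y hy
  have := hzero (j b • δ) (by simp [hε]) (by simp [hF]) (by simp [hFr]) (by
    rw [derivationValues_smul]
    rintro _ ⟨y, hy, rfl⟩
    obtain ⟨q, hq⟩ := hb y (hfin.mem_toFinset.2 hy)
    exact ⟨q, by rw [hq, Algebra.smul_def]⟩) (j b * y) (by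
    rw [derivationValues_smul]; exact ⟨y, hy, rfl⟩)
  exact (mul_eq_zero.1 this).resolve_left hb0

theorem coeff_mem_closure_deformedPoly (hd : d.Monic) (hp : p.degree < d.degree)
    (hcop : IsCoprime (f * h - g * fr) d)
    (hg : ∀ n, IsAlgebraic (IntermediateField.adjoin k
      (Set.range f.coeff ∪ Set.range fr.coeff)) (g.coeff n))
    (hh : ∀ n, IsAlgebraic (IntermediateField.adjoin k
      (Set.range f.coeff ∪ Set.range fr.coeff)) (h.coeff n)) :
    algebraMap K Ω '' (Set.range f.coeff ∪ Set.range fr.coeff ∪ Set.range d.coeff ∪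
        Set.range p.coeff) ⊆
      (AlgebraicIndependent.matroid k Ω).closure (insert (algebraMap K[X] Ω X)
        (Set.range (deformedPoly Ω d f p g).coeff ∪ Set.range (deformedPoly Ω d fr p h).coeff)) := by
  rintro _ ⟨c, hc, rfl⟩
  by_contra hn
  obtain ⟨δ, hδ, hne⟩ := exists_derivation_of_notMem_closure hn
  have hε := hδ _ (Set.mem_insert _ _)
  have hz := derivationValues_eq_zero hd hp hcop hg hh hε
    (fun n => hδ _ (Or.inr (Or.inl ⟨n, rfl⟩))) (fun n => hδ _ (Or.inr (Or.inr ⟨n, rfl⟩)))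
  have hX : algebraMap K[X] Ω X ≠ 0 :=
    (map_ne_zero_iff _ (IsFractionRing.injective K[X] Ω)).2 X_ne_zero
  apply hne
  rcases hc with ((⟨n, rfl⟩ | ⟨n, rfl⟩) | ⟨n, rfl⟩) | ⟨n, rfl⟩
  · exact hz _ (Or.inl (Or.inl (Or.inl ⟨n, rfl⟩)))
  · exact hz _ (Or.inl (Or.inl (Or.inr ⟨n, rfl⟩)))
  · exact hz _ (Or.inl (Or.inr ⟨n, rfl⟩))
  · exact (mul_eq_zero.1 (hz _ (Or.inr ⟨n, rfl⟩))).resolve_left hX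

end Deformation

/-! ### Minors at v and generic coprimality -/

namespace CompartmentGraph

variable {V : Type*} [DecidableEq V]

section Minors

variable {S : Type*} [CommRing S] [IsDomain S]

theorem charmatrix_deleteVertex {S : Type*} [CommRing S] (G : CompartmentGraph V) (r : V)
    (A : Matrix G.verts G.verts S) :
    (G.deleteVertex r A).charmatrix = A.charmatrix.submatrix Subtype.val Subtype.val := by
  ext i j : 1
  simp only [deleteVertex, Matrix.charmatrix_apply, Matrix.submatrix_apply, Matrix.diagonal_apply,
    Subtype.ext_iff]

theorem minorAt_eq {S : Type*} [CommRing S] (G : CompartmentGraph V) {v : V} (hv : v ∈ G.verts)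
    (A : Matrix G.verts G.verts S) :
    G.minorAt v A = A.charmatrix.adjugate ⟨v, hv⟩ ⟨v, hv⟩ := by
  rw [minorAt, Matrix.adjForm_indicator _ _ Subtype.val_injective,
    Finset.sum_eq_single (⟨v, hv⟩ : G.verts)]
  · rw [if_pos rfl]
  · intro i _ hi
    exact if_neg fun h => hi (Subtype.ext h)
  · simp

theorem charpoly_deleteVertex {S : Type*} [CommRing S] (G : CompartmentGraph V) {r : V}
    (hr : r ∈ G.verts) (A : Matrix G.verts G.verts S) :
    (G.deleteVertex r A).charpoly = A.charmatrix.adjugate ⟨r, hr⟩ ⟨r, hr⟩ := by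
  rw [Matrix.charpoly, charmatrix_deleteVertex]
  exact Matrix.det_submatrix_ne _ _ fun i => by rw [Ne, Ne, Subtype.ext_iff]

theorem charpoly_mul_deletedMinorAt_sub (G : CompartmentGraph V) {r v : V}
    (hr : r ∈ G.verts) (hv : v ∈ G.verts) (A : Matrix G.verts G.verts S) :
    A.charpoly * G.deletedMinorAt r v A - G.minorAt v A * (G.deleteVertex r A).charpoly =
      -(A.charmatrix.adjugate ⟨r, hr⟩ ⟨v, hv⟩ * A.charmatrix.adjugate ⟨v, hv⟩ ⟨r, hr⟩) := by
  have h1 := Matrix.det_mul_adjugate_submatrix_ne A.charmatrix ⟨r, hr⟩ ⟨v, hv⟩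
    (p := fun i => (i : V) ≠ r) (fun i => by rw [Ne, Ne, Subtype.ext_iff])
    (by rw [← G.charpoly_deleteVertex hr]; exact (Matrix.charpoly_monic _).ne_zero)
  have h2 : ∀ i : {i : G.verts // (i : V) ≠ r},
      (C (if ((i : G.verts) : V) = v then (1 : S) else 0)) =
        if (i : G.verts) = ⟨v, hv⟩ then (1 : S[X]) else 0 := by
    intro i
    simp only [Subtype.ext_iff]
    split_ifs <;> simp
  have h3 : G.deletedMinorAt r v A =
      (fun i : {i : G.verts // (i : V) ≠ r} => if (i : G.verts) = ⟨v, hv⟩ then (1 : S[X]) else 0) ⬝ᵥ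
        (A.charmatrix.submatrix Subtype.val Subtype.val).adjugate.mulVec
          (fun i => if (i : G.verts) = ⟨v, hv⟩ then 1 else 0) := by
    rw [deletedMinorAt, Matrix.adjForm, charmatrix_deleteVertex]
    simp only [h2]
  rw [minorAt_eq G hv, G.charpoly_deleteVertex hr, h3]
  exact h1

theorem map_minorAt {S T : Type*} [CommRing S] [CommRing T] (φ : S →+* T) (G : CompartmentGraph V)
    (v : V) (A : Matrix G.verts G.verts S) :
    (G.minorAt v A).map φ = G.minorAt v (A.map φ) := by
  rw [minorAt, Matrix.map_adjForm, minorAt]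
  congr 1 <;> · funext i; simp [apply_ite φ]

theorem map_deletedMinorAt {S T : Type*} [CommRing S] [CommRing T] (φ : S →+* T)
    (G : CompartmentGraph V) (r v : V) (A : Matrix G.verts G.verts S) :
    (G.deletedMinorAt r v A).map φ = G.deletedMinorAt r v (A.map φ) := by
  rw [deletedMinorAt, Matrix.map_adjForm, deletedMinorAt]
  congr 1 <;> · funext i; simp [apply_ite φ]

end Minors

section Coprime

variable {k : Type*} [Field k]

theorem StronglyConnected.adjugate_charmatrix_generic_ne_zero {G : CompartmentGraph V}
    (hG : G.StronglyConnected) (a b : G.verts) :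
    (G.mat (MvPolynomial.X (R := k))).charmatrix.adjugate a b ≠ 0 := by
  obtain ⟨p, d, hd, hp⟩ := hG.exists_tree b.2
  -- Specialise to the 0-1 matrix of a spanning tree rooted at `b`, where the entry is visibly
  -- nonzero.
  let y : V × V → k := fun e => if e.1 ≠ b ∧ e.2 = p e.1 then 1 else 0
  let φ : MvPolynomial (V × V) k →+* k := MvPolynomial.eval y
  intro h0
  have h1 := congrArg (Polynomial.map φ) h0
  rw [Matrix.map_adjugate_charmatrix, mat_map _ _ _ (map_zero φ), Polynomial.map_zero] at h1
  have hy : φ ∘ MvPolynomial.X = y := by funext e; simp [φ]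
  rw [hy] at h1
  let p' : G.verts → G.verts := fun i =>
    if h : (i : V) ≠ b then ⟨p i, (G.mem_verts _ (hp i i.2 h).1).1⟩ else i
  have hp' : ∀ i, i ≠ b → (p' i : V) = p i := by
    intro i hi
    have : (i : V) ≠ b := fun h => hi (Subtype.ext h)
    simp only [p', dif_pos this]
  refine Matrix.adjugate_charmatrix_ne_zero_of_tree (G.mat y) b p' (fun i => d i) ?_ hd ?_ a h1
  · intro i hi
    rw [hp' i hi]
    exact (hp i i.2 (fun h => hi (Subtype.ext h))).2
  · intro i j
    by_cases hi : i = b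
    · simp [mat, y, hi]
    · have hi' : (i : V) ≠ b := fun h => hi (Subtype.ext h)
      have hj : j = p' i ↔ (j : V) = p i := by rw [Subtype.ext_iff, hp' i hi]
      simp only [mat, y, hj]
      by_cases hjp : (j : V) = p i
      · have he := (hp i i.2 hi').1
        rw [← hjp] at he
        simp [hi, hi', hjp.symm, he]
      · simp [hjp]

/-- The block of `G₂` without `v` involves none of the variables of `G₁`. Specialising it to a
scalar matrix X turns `W(D)` into the scalar matrix `W`, whose determinant is a power of the nonzero
`W`. -/
theorem isCoprime_generic {G₁ G₂ : CompartmentGraph V} {v : V}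
    (hv : G₁.verts ∩ G₂.verts = {v}) (h₁ : G₁.StronglyConnected) (a b : G₁.verts)
    {K : Type*} [Field K] (ι : MvPolynomial (V × V) k →+* K) (hι : Function.Injective ι) :
    IsCoprime (((G₁.mat (MvPolynomial.X (R := k))).charmatrix.adjugate a b *
      (G₁.mat (MvPolynomial.X (R := k))).charmatrix.adjugate b a).map ι)
      (G₂.deleteVertex v (G₂.mat (ι ∘ MvPolynomial.X))).charpoly := by
  set W := (G₁.mat (MvPolynomial.X (R := k))).charmatrix.adjugate a b *
      (G₁.mat (MvPolynomial.X (R := k))).charmatrix.adjugate b a with hW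
  have hW0 : W ≠ 0 := mul_ne_zero (h₁.adjugate_charmatrix_generic_ne_zero a b)
    (h₁.adjugate_charmatrix_generic_ne_zero b a)
  set D := G₂.deleteVertex v (G₂.mat (MvPolynomial.X (R := k))) with hD
  have hDι : G₂.deleteVertex v (G₂.mat (ι ∘ MvPolynomial.X)) = D.map ι := by
    rw [← mat_map _ _ _ (map_zero ι)]; rfl
  rw [hDι]
  apply Matrix.isCoprime_charpoly_of_det_aeval_ne_zero
  rw [Matrix.aeval_map_map, ← RingHom.map_det]
  refine (map_ne_zero_iff ι hι).2 ?_
  let R := MvPolynomial (V × V) k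
  let ψ : R →+* R[X] := (MvPolynomial.aeval (fun e : V × V =>
    if (e.1 ∈ G₂.verts ∧ e.1 ≠ v) ∧ (e.2 ∈ G₂.verts ∧ e.2 ≠ v) then
      (if e.1 = e.2 then (X : R[X]) else 0) else C (MvPolynomial.X e)) : R →ₐ[k] R[X]).toRingHom
  have hψX : ∀ e, ψ (MvPolynomial.X e) =
      if (e.1 ∈ G₂.verts ∧ e.1 ≠ v) ∧ (e.2 ∈ G₂.verts ∧ e.2 ≠ v) then
      (if e.1 = e.2 then (X : R[X]) else 0) else C (MvPolynomial.X e) := fun e =>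
    MvPolynomial.aeval_X _ _
  have hψD : D.map ψ = algebraMap R[X] _ X := by
    ext i j : 1
    have hi : ((i : G₂.verts) : V) ∈ G₂.verts ∧ ((i : G₂.verts) : V) ≠ v := ⟨(i : G₂.verts).2, i.2⟩
    have hj : ((j : G₂.verts) : V) ∈ G₂.verts ∧ ((j : G₂.verts) : V) ≠ v := ⟨(j : G₂.verts).2, j.2⟩
    simp only [hD, deleteVertex, Matrix.map_apply, Matrix.submatrix_apply, mat,
      Matrix.algebraMap_matrix_apply, Algebra.algebraMap_self, RingHom.id_apply]
    by_cases hij : i = j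
    · subst hij
      rw [if_pos (Or.inl rfl), hψX, if_pos ⟨hi, hj⟩, if_pos rfl, if_pos rfl]
    · have hij' : ((i : G₂.verts) : V) ≠ (j : G₂.verts) := fun h =>
        hij (Subtype.ext (Subtype.ext h))
      rw [if_neg hij]
      split_ifs
      · rw [hψX, if_pos ⟨hi, hj⟩, if_neg hij']
      · exact map_zero ψ
  have hψW : W.map ψ = W.map C := by
    have hm : (G₁.mat (MvPolynomial.X (R := k))).map ψ =
        (G₁.mat (MvPolynomial.X (R := k))).map (C : R →+* R[X]) := by
      rw [mat_map _ _ _ (map_zero ψ), mat_map _ _ _ (map_zero _)]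
      refine mat_congr _ fun i hi j hj => ?_
      change ψ (MvPolynomial.X (i, j)) = C (MvPolynomial.X (i, j))
      rw [hψX, if_neg]
      rintro ⟨⟨h1, h2⟩, -⟩
      have : i ∈ G₁.verts ∩ G₂.verts := Finset.mem_inter.2 ⟨hi, h1⟩
      rw [hv] at this
      exact h2 (Finset.mem_singleton.1 this)
    rw [hW, Polynomial.map_mul, Polynomial.map_mul]
    simp only [Matrix.map_adjugate_charmatrix, hm]
  intro hdet
  have h2 := congrArg ψ hdet
  rw [RingHom.map_det, ← Matrix.aeval_map_map, hψD, hψW, aeval_algebraMap_apply, map_zero] at h2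
  have h3 : aeval (X : R[X]) (W.map (C : R →+* R[X])) = W := by
    rw [aeval_def, eval₂_map]
    exact eval₂_C_X
  rw [h3, Matrix.algebraMap_eq_diagonal, Matrix.det_diagonal] at h2
  simp only [Pi.algebraMap_apply, Algebra.algebraMap_self, RingHom.id_apply,
    Finset.prod_const] at h2
  exact pow_ne_zero _ hW0 h2

end Coprime

end CompartmentGraph

/-- Submodularity used twice: first `S` is independent of `Q`, then `T` replaces `Q`. -/
theorem Matroid.eRk_add_eRk_le_of_indep_union {α : Type*} (M : Matroid α) {P Q S T : Set α}
    (hPQ : M.Indep (P ∪ Q)) (hdisj : Disjoint P Q) (hP : P.Finite) (hQ : Q.Finite)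
    (hS : S ⊆ M.closure P) (hT : T ⊆ M.closure Q) :
    M.eRk S + M.eRk T ≤ M.eRk (S ∪ T) := by
  have hrk : M.eRk (P ∪ Q) = P.encard + Q.encard := by
    rw [hPQ.eRk_eq_encard, Set.encard_union_eq hdisj]
  have hrP : M.eRk (S ∪ P) ≤ P.encard := by
    refine le_trans (M.eRk_mono (Set.union_subset hS (M.subset_closure P ?_))) ?_
    · exact (hPQ.subset Set.subset_union_left).subset_ground
    · rw [M.eRk_closure_eq]; exact M.eRk_le_encard P
  have hrQ : M.eRk (T ∪ Q) ≤ Q.encard := by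
    refine le_trans (M.eRk_mono (Set.union_subset hT (M.subset_closure Q ?_))) ?_
    · exact (hPQ.subset Set.subset_union_right).subset_ground
    · rw [M.eRk_closure_eq]; exact M.eRk_le_encard Q
  have h1 := M.eRk_inter_add_eRk_union_le (S ∪ Q) (S ∪ P)
  have h2 := M.eRk_inter_add_eRk_union_le (S ∪ T) (T ∪ Q)
  have h3 : M.eRk S ≤ M.eRk ((S ∪ Q) ∩ (S ∪ P)) :=
    M.eRk_mono (Set.subset_inter Set.subset_union_left Set.subset_union_left)
  have h4 : M.eRk T ≤ M.eRk ((S ∪ T) ∩ (T ∪ Q)) :=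
    M.eRk_mono (Set.subset_inter Set.subset_union_right Set.subset_union_left)
  have h5 : P.encard + Q.encard ≤ M.eRk ((S ∪ Q) ∪ (S ∪ P)) := by
    rw [← hrk]
    exact M.eRk_mono (by tauto_set)
  have h6 : M.eRk (S ∪ Q) ≤ M.eRk ((S ∪ T) ∪ (T ∪ Q)) := M.eRk_mono (by tauto_set)
  have hPf : P.encard ≠ ⊤ := hP.encard_lt_top.ne
  have hQf : Q.encard ≠ ⊤ := hQ.encard_lt_top.ne
  have e1 : M.eRk S + Q.encard ≤ M.eRk (S ∪ Q) := by
    refine (ENat.add_le_add_iff_right hPf).1 ?_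
    calc M.eRk S + Q.encard + P.encard = M.eRk S + (P.encard + Q.encard) := by ring
      _ ≤ _ := (add_le_add h3 h5).trans h1
      _ ≤ _ := by gcongr
  refine (ENat.add_le_add_iff_right hQf).1 ?_
  calc M.eRk S + M.eRk T + Q.encard = M.eRk T + (M.eRk S + Q.encard) := by ring
    _ ≤ M.eRk T + M.eRk (S ∪ Q) := by gcongr
    _ ≤ _ := (add_le_add h4 h6).trans h2
    _ ≤ _ := by gcongr

/-! ### Lower bound for the glued graph -/

namespace CompartmentGraph

variable {V : Type*} [DecidableEq V]

section Closures

variable {k Ω : Type*} [Field k] [Field Ω] [Algebra k Ω]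

theorem map_coeffSet {S T : Type*} [CommRing S] [CommRing T] (φ : S →+* T)
    (G : CompartmentGraph V) (r : V) (A : Matrix G.verts G.verts S) :
    G.coeffSet r (A.map φ) = φ '' G.coeffSet r A := by
  have h : G.deleteVertex r (A.map φ) = (G.deleteVertex r A).map φ := rfl
  rw [coeffSet, coeffSet, Set.image_union, ← Set.range_comp, ← Set.range_comp, h,
    Matrix.charpoly_map, Matrix.charpoly_map]
  congr 2 <;> · funext n; simp

theorem coeffSet_subset_closure (G : CompartmentGraph V) (r : V) (x : V × V → Ω) :
    G.coeffSet r (G.mat x) ⊆ (AlgebraicIndependent.matroid k Ω).closure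
      (x '' {e | e.1 ∈ G.verts ∧ e.2 ∈ G.verts}) := by
  have hA : ∀ i j, G.mat x i j ∈ algClosureOf k (x '' {e | e.1 ∈ G.verts ∧ e.2 ∈ G.verts}) := by
    intro i j
    simp only [mat]
    split_ifs
    · exact mem_algClosureOf.2 (Matroid.mem_closure_of_mem _ ⟨(i, j), ⟨i.2, j.2⟩, rfl⟩)
    · exact zero_mem _
  rintro _ (⟨n, rfl⟩ | ⟨n, rfl⟩) <;> rw [← mem_algClosureOf]
  · exact Matrix.coeff_charpoly_mem _ hA n
  · have hD : ∀ i j, G.deleteVertex r (G.mat x) i j ∈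
        algClosureOf k (x '' {e | e.1 ∈ G.verts ∧ e.2 ∈ G.verts}) := fun i j => hA i j
    exact Matrix.coeff_charpoly_mem _ hD n

/-- The coefficients of the characteristic polynomial without `v` and of the feedback at `v`. -/
def feedbackSet {S : Type*} [CommRing S] (G : CompartmentGraph V) (v : V)
    (A : Matrix G.verts G.verts S) : Set S :=
  Set.range (G.deleteVertex v A).charpoly.coeff ∪ Set.range (G.feedbackPoly v A).coeff

theorem feedbackSet_subset_closure (G : CompartmentGraph V) (v : V) (x : V × V → Ω) :
    G.feedbackSet v (G.mat x) ⊆ (AlgebraicIndependent.matroid k Ω).closure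
      (x '' {e | e.1 ∈ G.verts ∧ e.2 ∈ G.verts ∧ e ≠ (v, v)}) := by
  set F := algClosureOf k (x '' {e | e.1 ∈ G.verts ∧ e.2 ∈ G.verts ∧ e ≠ (v, v)})
  have hA : ∀ i j : G.verts, ((i : V), (j : V)) ≠ (v, v) → G.mat x i j ∈ F := by
    intro i j hij
    simp only [mat]
    split_ifs
    · exact mem_algClosureOf.2 (Matroid.mem_closure_of_mem _ ⟨(i, j), ⟨i.2, j.2, hij⟩, rfl⟩)
    · exact zero_mem _
  have hD : ∀ i j, G.deleteVertex v (G.mat x) i j ∈ F := fun i j =>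
    hA i j fun h => i.2 (congrArg Prod.fst h)
  rintro _ (⟨n, rfl⟩ | ⟨n, rfl⟩) <;> rw [← mem_algClosureOf]
  · exact Matrix.coeff_charpoly_mem _ hD n
  · refine Matrix.coeff_adjForm_mem _ hD (fun i => ?_) (fun i => ?_) n
    · rw [rowAt]
      split_ifs
      · exact hA _ _ fun h => i.2 (congrArg Prod.snd h)
      · exact zero_mem _
    · rw [colAt]
      split_ifs
      · exact hA _ _ fun h => i.2 (congrArg Prod.fst h)
      · exact zero_mem _

theorem coeffSet_subset_closure_feedbackSet (G : CompartmentGraph V) {v : V} (hv : v ∈ G.verts)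
    (x : V × V → Ω) :
    G.coeffSet v (G.mat x) ⊆ (AlgebraicIndependent.matroid k Ω).closure
      (insert (x (v, v)) (G.feedbackSet v (G.mat x))) := by
  have hmem : ∀ y ∈ insert (x (v, v)) (G.feedbackSet v (G.mat x)),
      y ∈ algClosureOf k (insert (x (v, v)) (G.feedbackSet v (G.mat x))) := fun y hy =>
    mem_algClosureOf.2 (Matroid.mem_closure_of_mem _ hy)
  have hd : ∀ n, (G.deleteVertex v (G.mat x)).charpoly.coeff n ∈
      algClosureOf k (insert (x (v, v)) (G.feedbackSet v (G.mat x))) := fun n =>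
    hmem _ (Or.inr (Or.inl ⟨n, rfl⟩))
  rintro _ (⟨n, rfl⟩ | ⟨n, rfl⟩) <;> rw [← mem_algClosureOf]
  · rw [G.charpoly_eq_sub_feedbackPoly hv]
    exact Polynomial.forall_coeff_sub_mem _ (Polynomial.forall_coeff_mul_mem _
      (Polynomial.forall_coeff_X_sub_C_mem _ (hmem _ (Set.mem_insert _ _))) hd)
      (fun n => hmem _ (Or.inr (Or.inr ⟨n, rfl⟩))) n
  · exact hd n

/-- The coefficients have full rank inside the closure of at most `m + 1` generators, so they span
that closure, which contains the minors. -/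
theorem StronglyConnected.isAlgebraic_coeff_minorAt {G : CompartmentGraph V}
    (hG : G.StronglyConnected) {r v : V} (hv : v ∈ G.verts) {x : V × V → Ω} (hx : ∀ e, x e ≠ 0)
    (hdim : (AlgebraicIndependent.matroid k Ω).eRk (G.coeffSet r (G.mat x)) =
      ((G.edges.card + 1 : ℕ) : ℕ∞)) (n : ℕ) :
    IsAlgebraic (IntermediateField.adjoin k (G.coeffSet r (G.mat x)))
        ((G.minorAt v (G.mat x)).coeff n) ∧
      IsAlgebraic (IntermediateField.adjoin k (G.coeffSet r (G.mat x)))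
        ((G.deletedMinorAt r v (G.mat x)).coeff n) := by
  obtain ⟨T, hT, h⟩ := hG.exists_generators (k := k) hv hx
  have hsub : G.coeffSet r (G.mat x) ⊆
      (AlgebraicIndependent.matroid k Ω).closure (insert (x (v, v)) T) := by
    rintro _ (⟨n, rfl⟩ | ⟨n, rfl⟩)
    · exact mem_algClosureOf.1 (h r n).1
    · exact mem_algClosureOf.1 (h r n).2.1
  have hfin : (AlgebraicIndependent.matroid k Ω).IsRkFinite (G.coeffSet r (G.mat x)) := by
    rw [← Matroid.eRk_ne_top_iff, hdim]
    exact ENat.natCast_ne_top _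
  have hcl := hfin.closure_eq_closure_of_subset_of_eRk_ge_eRk hsub (by
    rw [Matroid.eRk_closure_eq, hdim]
    refine (Matroid.eRk_le_encard _ _).trans ((Set.encard_insert_le _ _).trans ?_)
    push_cast
    gcongr)
  rw [Matroid.closure_closure] at hcl
  rw [← mem_closure_iff_isAlgebraic, ← mem_closure_iff_isAlgebraic, hcl]
  exact ⟨mem_algClosureOf.1 (h r n).2.2.1, mem_algClosureOf.1 (h r n).2.2.2⟩

end Closures

section Lower

variable {k K Ω : Type*} [Field k] [CharZero k] [Field K] [Field Ω] [Algebra k K] [Algebra k Ω]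
  [Algebra K Ω] [IsScalarTower k K Ω] [Algebra K[X] Ω] [IsScalarTower K K[X] Ω]
  [IsFractionRing K[X] Ω]

/-- The entries in row `v` and columns in `G` other than `v` are multiplied by `c`. -/
def scaleRow {S : Type*} [Mul S] (G : CompartmentGraph V) (v : V) (c : S) (x : V × V → S) :
    V × V → S :=
  fun e => if e.1 = v ∧ e.2 ∈ G.verts ∧ e.2 ≠ v then c * x e else x e

theorem feedbackPoly_scaleRow {S : Type*} [CommRing S] [IsDomain S] (G : CompartmentGraph V)
    (v : V) (c : S) (x : V × V → S) :
    G.deleteVertex v (G.mat (G.scaleRow v c x)) = G.deleteVertex v (G.mat x) ∧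
      G.feedbackPoly v (G.mat (G.scaleRow v c x)) = C c * G.feedbackPoly v (G.mat x) := by
  have h1 : G.deleteVertex v (G.mat (G.scaleRow v c x)) = G.deleteVertex v (G.mat x) := by
    ext i j
    simp [deleteVertex, mat, scaleRow, i.2]
  have h2 : G.colAt v (G.mat (G.scaleRow v c x)) = G.colAt v (G.mat x) := by
    funext i
    simp [colAt, mat, scaleRow]
  have h3 : G.rowAt v (G.mat (G.scaleRow v c x)) = c • G.rowAt v (G.mat x) := by
    funext j
    have := j.2
    by_cases hv : v ∈ G.verts <;> simp [rowAt, mat, scaleRow, hv, this]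
  refine ⟨h1, ?_⟩
  rw [feedbackPoly, h1, h2, h3, feedbackPoly, Matrix.adjForm, Matrix.adjForm, ← smul_eq_mul,
    ← smul_dotProduct]
  congr 1
  funext i
  simp

theorem map_feedbackPoly {S T : Type*} [CommRing S] [IsDomain S] [CommRing T] [IsDomain T]
    (φ : S →+* T) (G : CompartmentGraph V) (v : V) (A : Matrix G.verts G.verts S) :
    (G.feedbackPoly v A).map φ = G.feedbackPoly v (A.map φ) := by
  rw [feedbackPoly, Matrix.map_adjForm, feedbackPoly]
  congr 1
  · funext i
    by_cases h : v ∈ G.verts <;> simp [rowAt, h]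
  · funext i
    by_cases h : v ∈ G.verts <;> simp [colAt, h]

theorem le_eRk_coeffSet_union_of_hasExpectedDimension [Infinite k] {G₁ G₂ : CompartmentGraph V}
    {r v : V} (h₁ : G₁.StronglyConnected) (hv : G₁.verts ∩ G₂.verts = {v}) (hr : r ∈ G₁.verts)
    {x : V × V → K} (hx : AlgebraicIndependent k x)
    (hd₁ : G₁.HasExpectedDimension k r) (hd₂ : G₂.HasExpectedDimension k v) :
    ((G₁.edges.card + G₂.edges.card + 1 : ℕ) : ℕ∞) ≤
      (AlgebraicIndependent.matroid k Ω).eRk ((G₁.union G₂).coeffSet r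
        ((G₁.union G₂).mat (algebraMap K Ω ∘ x))) := by
  have hv12 := Finset.mem_inter.1 (hv ▸ Finset.mem_singleton_self v)
  have hvmem : ∀ i, i ∈ G₁.verts → i ∈ G₂.verts → i = v := by
    intro i h1 h2
    have : i ∈ G₁.verts ∩ G₂.verts := Finset.mem_inter.2 ⟨h1, h2⟩
    rw [hv] at this
    exact Finset.mem_singleton.1 this
  let M := AlgebraicIndependent.matroid k Ω
  set φ := algebraMap K Ω with hφ
  have hφinj : Function.Injective φ := φ.injective
  have hxΩ : AlgebraicIndependent k (φ ∘ x) :=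
    hx.map' (f := IsScalarTower.toAlgHom k K Ω) hφinj
  set j := algebraMap K[X] Ω with hj
  have hjinj : Function.Injective j := IsFractionRing.injective K[X] Ω
  set ε := j X with hε
  let A₁ := G₁.mat x
  let A₂ := G₂.mat x
  have hA₁ : G₁.mat (φ ∘ x) = A₁.map φ := (mat_map _ _ _ (map_zero φ)).symm
  have hA₂ : G₂.mat (φ ∘ x) = A₂.map φ := (mat_map _ _ _ (map_zero φ)).symm
  -- The special point: only the feedback of `G₂` at `v` acquires the factor ε. The shared entry at
  -- `(v, v)` is unchanged, so `G₁` does not see it.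
  let y := G₂.scaleRow v ε (φ ∘ x)
  have hy₁ : G₁.mat y = A₁.map φ := by
    rw [← hA₁]
    refine mat_congr _ fun i _ j hj => ?_
    simp only [y, scaleRow]
    rw [if_neg]
    rintro ⟨-, h2, h3⟩
    exact h3 (hvmem _ hj h2)
  obtain ⟨hy₂, hy₃⟩ := G₂.feedbackPoly_scaleRow v ε (φ ∘ x)
  set d := (G₂.deleteVertex v A₂).charpoly with hd
  set p := G₂.feedbackPoly v A₂ with hp
  have hdΩ : (G₂.deleteVertex v (G₂.mat y)).charpoly = d.map φ := by
    rw [hy₂, hA₂, hd, ← Matrix.charpoly_map]; rfl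
  have hpΩ : G₂.feedbackPoly v (G₂.mat y) = C ε * p.map φ := by
    rw [hy₃, hA₂, hp, map_feedbackPoly]
  have hF : ((G₁.union G₂).mat y).charpoly = deformedPoly Ω d A₁.charpoly p (G₁.minorAt v A₁) := by
    rw [charpoly_union hv, hdΩ, hpΩ, hy₁, deformedPoly, Matrix.charpoly_map, ← map_minorAt,
      Polynomial.map_mul, Polynomial.map_mul, mul_assoc]
  have hFr : ((G₁.union G₂).deleteVertex r ((G₁.union G₂).mat y)).charpoly =
      deformedPoly Ω d (G₁.deleteVertex r A₁).charpoly p (G₁.deletedMinorAt r v A₁) := by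
    have : G₁.deleteVertex r (A₁.map φ) = (G₁.deleteVertex r A₁).map φ := rfl
    rw [charpoly_deleteVertex_union hv hr, hdΩ, hpΩ, hy₁, deformedPoly, this, Matrix.charpoly_map,
      ← map_deletedMinorAt, Polynomial.map_mul, Polynomial.map_mul, mul_assoc]
  have halg := fun n => h₁.isAlgebraic_coeff_minorAt (r := r) hv12.1 hx.ne_zero
    ((G₁.hasExpectedDimension_iff hr hx).1 hd₁) n
  have hcop : IsCoprime (A₁.charpoly * G₁.deletedMinorAt r v A₁ -
      G₁.minorAt v A₁ * (G₁.deleteVertex r A₁).charpoly) d := by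
    let ι : MvPolynomial (V × V) k →+* K := (MvPolynomial.aeval x).toRingHom
    have hι : ι ∘ MvPolynomial.X = x := by funext e; simp [ι]
    have := isCoprime_generic (G₂ := G₂) hv h₁ ⟨r, hr⟩ ⟨v, hv12.1⟩ ι hx
    rw [Polynomial.map_mul, Matrix.map_adjugate_charmatrix, Matrix.map_adjugate_charmatrix,
      mat_map _ _ _ (map_zero ι), hι] at this
    rw [charpoly_mul_deletedMinorAt_sub G₁ hr hv12.1]
    exact this.neg_left
  have hsub := coeff_mem_closure_deformedPoly (Ω := Ω) (k := k) (f := A₁.charpoly)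
    (fr := (G₁.deleteVertex r A₁).charpoly) (Matrix.charpoly_monic _)
    (G₂.degree_feedbackPoly_lt v A₂) hcop (fun n => (halg n).1) (fun n => (halg n).2)
  rw [← hF, ← hFr] at hsub
  let S := G₁.coeffSet r (G₁.mat (φ ∘ x))
  let T := G₂.feedbackSet v (G₂.mat (φ ∘ x))
  have hSim : S = φ '' G₁.coeffSet r A₁ := by
    simp only [S]; rw [hA₁, map_coeffSet]
  have hTim : T = φ '' G₂.feedbackSet v A₂ := by
    have : G₂.deleteVertex v (A₂.map φ) = (G₂.deleteVertex v A₂).map φ := rfl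
    simp only [T]
    rw [hA₂, feedbackSet, feedbackSet, Set.image_union, ← Set.range_comp, ← Set.range_comp,
      ← map_feedbackPoly, this, Matrix.charpoly_map]
    congr 2 <;> · funext n; simp
  have hST : S ∪ T ⊆ M.closure (insert ε ((G₁.union G₂).coeffSet r ((G₁.union G₂).mat y))) := by
    rw [hSim, hTim, ← Set.image_union, feedbackSet, ← Set.union_assoc]
    exact hsub
  -- `S ∪ T` comes from `K`, over which ε is transcendental.
  have hεST : ε ∉ M.closure (S ∪ T) := by
    rw [hSim, hTim, ← Set.image_union, mem_closure_iff_isAlgebraic]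
    intro h
    have hle : IntermediateField.adjoin k (φ '' (G₁.coeffSet r A₁ ∪ G₂.feedbackSet v A₂)) ≤
        (IsScalarTower.toAlgHom k K Ω).fieldRange :=
      IntermediateField.adjoin_le_iff.2 (Set.image_subset_range _ _)
    let e := (AlgEquiv.ofInjectiveField (IsScalarTower.toAlgHom k K Ω)).symm
    have hK : IsAlgebraic K ε := h.ringHom_of_comp_eq
      (e.toRingHom.comp (IntermediateField.inclusion hle).toRingHom) (RingHom.id Ω)
      (RingHom.injective _) (by
        ext a
        exact congrArg Subtype.val
          (AlgEquiv.apply_symm_apply (AlgEquiv.ofInjectiveField (IsScalarTower.toAlgHom k K Ω))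
            (IntermediateField.inclusion hle a)))
    exact Polynomial.transcendental_X K ((isAlgebraic_algebraMap_iff hjinj).1 hK)
  have hrkS : M.eRk S = ((G₁.edges.card + 1 : ℕ) : ℕ∞) :=
    (G₁.hasExpectedDimension_iff hr hxΩ).1 hd₁
  have hrkT : ((G₂.edges.card : ℕ) : ℕ∞) ≤ M.eRk T := by
    have h1 : M.eRk (G₂.coeffSet v (G₂.mat (φ ∘ x))) = ((G₂.edges.card + 1 : ℕ) : ℕ∞) :=
      (G₂.hasExpectedDimension_iff hv12.2 hxΩ).1 hd₂
    have h2 := M.eRk_mono (G₂.coeffSet_subset_closure_feedbackSet (k := k) hv12.2 (φ ∘ x))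
    rw [Matroid.eRk_closure_eq, h1] at h2
    have h3 := h2.trans (M.eRk_insert_le_add_one _ _)
    push_cast at h3
    exact (ENat.add_le_add_iff_right (by simp)).1 h3
  have hrkST : M.eRk S + M.eRk T ≤ M.eRk (S ∪ T) := by
    let I₁ : Set (V × V) := {e | e.1 ∈ G₁.verts ∧ e.2 ∈ G₁.verts}
    -- The feedback data avoid `(v, v)`, the only position common to both graphs.
    let I₂ : Set (V × V) := {e | e.1 ∈ G₂.verts ∧ e.2 ∈ G₂.verts ∧ e ≠ (v, v)}
    have hdisj : Disjoint I₁ I₂ := by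
      rw [Set.disjoint_left]
      rintro ⟨a, b⟩ ⟨h1, h2⟩ ⟨h3, h4, h5⟩
      exact h5 (Prod.ext (hvmem _ h1 h3) (hvmem _ h2 h4))
    have hf₁ : I₁.Finite := (G₁.verts ×ˢ G₁.verts).finite_toSet.subset fun e he =>
      Finset.mem_coe.2 (Finset.mem_product.2 ⟨he.1, he.2⟩)
    have hf₂ : I₂.Finite := (G₂.verts ×ˢ G₂.verts).finite_toSet.subset fun e he =>
      Finset.mem_coe.2 (Finset.mem_product.2 ⟨he.1, he.2.1⟩)
    refine M.eRk_add_eRk_le_of_indep_union (P := (φ ∘ x) '' I₁) (Q := (φ ∘ x) '' I₂) ?_ ?_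
      (hf₁.image _) (hf₂.image _) (G₁.coeffSet_subset_closure r _)
      (G₂.feedbackSet_subset_closure v _)
    · have hI : M.Indep (Set.range (φ ∘ x)) := hxΩ.to_subtype_range
      refine hI.subset ?_
      rw [← Set.image_union]
      exact Set.image_subset_range _ _
    · exact Set.disjoint_image_of_injective hxΩ.injective hdisj
  have hfinal : M.eRk (S ∪ T) ≤ M.eRk ((G₁.union G₂).coeffSet r ((G₁.union G₂).mat y)) := by
    -- Adjoining ε adds exactly one to the rank of `S ∪ T` and at most one to that of the
    -- coefficients, so it cancels.
    have h1 := M.eRk_mono (Set.insert_subset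
      (M.mem_closure_of_mem (Set.mem_insert ε _)) hST)
    rw [Matroid.eRk_closure_eq, Matroid.eRk_insert_eq_add_one ⟨Set.mem_univ _, hεST⟩] at h1
    exact (ENat.add_le_add_iff_right (by simp)).1 (h1.trans (M.eRk_insert_le_add_one _ _))
  calc ((G₁.edges.card + G₂.edges.card + 1 : ℕ) : ℕ∞)
      = ((G₁.edges.card + 1 : ℕ) : ℕ∞) + (G₂.edges.card : ℕ) := by push_cast; ring
    _ ≤ M.eRk S + M.eRk T := by rw [hrkS]; gcongr
    _ ≤ _ := hrkST.trans (hfinal.trans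
      (eRk_coeffSet_le _ (Finset.mem_union_left _ hr) hxΩ y))

end Lower

end CompartmentGraph

/-! ### The proposition -/

theorem proposition4p8 {𝕜 : Type*} [RCLike 𝕜] {V : Type*} [DecidableEq V]
    (G' G'' : CompartmentGraph V) (r v : V)
    (hG' : G'.StronglyConnected) (hG'' : G''.StronglyConnected)
    (hv : G'.verts ∩ G''.verts = {v}) (hE : Disjoint G'.edges G''.edges)
    (hr : r ∈ G'.verts) :
    (G'.HasExpectedDimension 𝕜 r → G''.HasExpectedDimension 𝕜 v →
      (G'.union G'').HasExpectedDimension 𝕜 r) ∧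
    (¬ G''.HasExpectedDimension 𝕜 v → ¬ (G'.union G'').HasExpectedDimension 𝕜 r) := by
  let K := FractionRing (MvPolynomial (V × V) 𝕜)
  let Ω := FractionRing K[X]
  have hv2 : v ∈ G''.verts := (Finset.mem_inter.1 (hv ▸ Finset.mem_singleton_self v)).2
  have hru : r ∈ (G'.union G'').verts := Finset.mem_union_left _ hr
  have hx : AlgebraicIndependent 𝕜
      (algebraMap (MvPolynomial (V × V) 𝕜) K ∘ (MvPolynomial.X : V × V → _)) :=
    (MvPolynomial.algebraicIndependent_X (V × V) 𝕜).map'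
      (f := IsScalarTower.toAlgHom 𝕜 (MvPolynomial (V × V) 𝕜) K)
      (IsFractionRing.injective (MvPolynomial (V × V) 𝕜) K)
  set x := algebraMap (MvPolynomial (V × V) 𝕜) K ∘ (MvPolynomial.X : V × V → _)
  have hxΩ : AlgebraicIndependent 𝕜 (algebraMap K Ω ∘ x) :=
    hx.map' (f := IsScalarTower.toAlgHom 𝕜 K Ω) (algebraMap K Ω).injective
  have hcard : (G'.union G'').edges.card = G'.edges.card + G''.edges.card :=
    Finset.card_union_of_disjoint hE
  have hup := CompartmentGraph.eRk_coeffSet_union_le (k := 𝕜) hG' hv hr hxΩ.ne_zero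
  rw [CompartmentGraph.hasExpectedDimension_iff _ hru hxΩ, hcard]
  refine ⟨fun h1 h2 => le_antisymm ?_ ?_, fun h1 h2 => ?_⟩
  · rw [(G''.hasExpectedDimension_iff hv2 hxΩ).1 h2] at hup
    refine hup.trans_eq ?_
    push_cast; ring
  · exact CompartmentGraph.le_eRk_coeffSet_union_of_hasExpectedDimension hG' hv hr hx h1 h2
  · rw [G''.hasExpectedDimension_iff hv2 hxΩ] at h1
    have hlt := (hG''.eRk_coeffSet_le_card (k := 𝕜) hv2 hxΩ.ne_zero).lt_of_ne h1
    -- Failing the expected dimension means rank at most m'', since m'' + 1 is the maximum; the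
    -- union then falls short by at least one.
    have hle := Order.le_of_lt_add_one (hlt.trans_eq (by push_cast; rfl))
    rw [h2] at hup
    have h3 := hup.trans (add_le_add_right hle _)
    have h4 : ((G'.edges.card + G''.edges.card + 1 : ℕ) : ℕ∞) ≤
      ((G'.edges.card + G''.edges.card : ℕ) : ℕ∞) := by exact_mod_cast h3
    have := Nat.cast_le.1 h4
    omega
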